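/- \textbf{Conventions.} For coprime positive integers $s,r$, or $(s,r)=(1,0)$, the continued fraction of the pair $(s:r)$ is the empty sequence if $(s:r)=(1:0)$, and otherwise $(c_1,c_2,\ldots)$, where $c_1=\lfloor s/r\rfloor$ and $(c_2,\ldots)$ is the continued fraction of $(r:s-c_1r)$; moreover, sequences $(c_1,\ldots,c_{l-1},1)$ and $(c_1,\ldots,c_{l-1}+1)$ with $l\ge 2$ are identified. For $n\ge 0$ let $(q)_n=\prod_{i=1}^n(1-q^i)$, and let $\left[{P\atop N}\right]=\frac{(q)_P}{(q)_N(q)_{P-N}}$ if $P\ge N\ge 0$ and $\left[{P\atop N}\right]=0$ otherwise, where $q$ is an indeterminate. \textbf{Statement.} Let $p$ and $p'$ be positive coprime integers such that $(p':p)$ has continued fraction $(c_1,\ldots,c_{t-1},c_t+2)$ with $t\ge 1$ and all $c_k\ge 0$. Let $1\le u\le t$ and $1\le d\le c_u$, let $r,s$ be such that $(s:r)$ has continued fraction $(c_1,\ldots,c_{u-1},d)$, and let $N\ge 0$ be an integer. Put $$(f_1,\ldots,f_{t+1})=(c_1,\ldots,c_{u-1},d,c_u-d,c_{u+1},\ldots,c_t).$$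 Consider all sequences $n^{(1)},\ldots,n^{(x)}$ with $u\le x\le t+1$, where $n^{(k)}=(n_{k,1},\ldots,n_{k,f_k})$ consists of integers with $n_{k,0}\ge n_{k,1}\ge\cdots\ge n_{k,f_k}\ge 0$ and has weight $\mathrm{wt}(n^{(k)})=\sum_{i=1}^{f_k} n_{k,i}$, such that (i) $\mathrm{wt}(n^{(k)})\le w_k$ for $1\le k\le x$, and $\mathrm{wt}(n^{(x)})=w_x$; (ii) $\mathrm{wt}(n^{(u)})<w_u$ if $u<x$; (iii) $n_{k,f_k}>0$ if $u<k<x$; (iv) $n_{x,f_x}=0$ if $x<t+1$. Here $w_1=\infty$ and $n_{1,0}=N$; for $2\le k\le u$, $w_k=n_{k-1,f_{k-1}}$ and $n_{k,0}=w_{k-1}-\mathrm{wt}(n^{(k-1)})$; $w_{u+1}=w_u-1-\mathrm{wt}(n^{(u)})$ and $n_{u+1,0}=n_{u,f_u}+1$; and for $u+2\le k\le x$, $w_k=n_{k-1,f_{k-1}}-1$ and $n_{k,0}=w_{k-1}+1-\mathrm{wt}(n^{(k-1)})$; with $\infty\pm a=\infty$ for integers $a$. There are finitely many such sequences. Let $$B=\sum_{k=-\infty}^{\infty}\left(q^{k^2pp'+k(p'r-ps)}\left[{2N\atop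 N+pk}\right]-q^{(kp+r)(kp'+s)}\left[{2N\atop N+pk+r}\right]\right),$$ a sum with finitely many non-zero terms, and let $$E=n_{u,d}+\sum_{k=1}^{u}\sum_{i=1}^{f_k}n_{k,i}^2+\sum_{k=u+1}^{x}\sum_{i=1}^{f_k}n_{k,i}(n_{k,i}-1),\qquad G_{k,i}=\left[{2\left(w_k-\sum_{j=1}^{i}n_{k,j}\right)+n_{k,i-1}+n_{k,i}\atop n_{k,i-1}-n_{k,i}}\right].$$ Then $B$ is a polynomial in $q$ with integer coefficients, and the following identities hold, where the sums are over all sequences described above and $\delta$ is the Kronecker delta. If $u>1$, then $$B=(q)_{2N}\sum q^{E}\,\frac{1}{(q)_{2n_{1,f_1}}}\prod_{i=1}^{f_1}\frac{1}{(q)_{n_{1,i-1}-n_{1,i}}}\prod_{k=2}^{x}\;\prod_{i=1+\delta_{2,k}}^{f_k}G_{k,i}.$$ If $u=1$, then $$B=(q)_{2N}\sum q^{E}\,\frac{1}{(q)_{2(n_{2,f_2}-1)}}\prod_{i=1}^{f_1}\frac{1}{(q)_{n_{1,i-1}-n_{1,i}}}\prod_{i=1}^{f_2}\frac{1}{(q)_{n_{2,i-1}-n_{2,i}}}\prod_{k=3}^{x}\;\prod_{i=1+\delta_{3,k}}^{f_k}G_{k,i}.$$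 (If $u=1$, every sequence in the sum has $x\ge 3$ and $n_{2,f_2}\ge 1$.) -/

import Mathlib

namespace BurgeTree

/-! ### Continued fractions of pairs `(s : r)` -/

/-- The canonical continued fraction of the pair `(s : r)`: the empty sequence when `r = 0`, and
otherwise `c₁ = ⌊s / r⌋` followed by the continued fraction of `(r : s - c₁ r)`. -/
def contFrac (s r : ℕ) : List ℕ :=
  if _h : r = 0 then [] else s / r :: contFrac r (s % r)
termination_by r
decreasing_by exact Nat.mod_lt _ (Nat.pos_of_ne_zero _h)

/-- `l` is a continued fraction for `(s : r)`, where `s` and `r` are positive and coprime, or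
`(s : r) = (1 : 0)`. Either `l` is the canonical one, or it is obtained from the canonical one
by replacing its last entry `a + 1` by the two entries `a, 1`. -/
def IsContFrac (l : List ℕ) (s r : ℕ) : Prop :=
  0 < s ∧ Nat.Coprime s r ∧
    (l = contFrac s r ∨
      ∃ (l' : List ℕ) (a : ℕ), contFrac s r = l' ++ [a + 1] ∧ l = l' ++ [a, 1])

/-! ### Gaussian polynomials, as elements of `ℚ(q)` -/

/-- The formal variable `q`. -/
noncomputable def q : RatFunc ℚ := RatFunc.X

/-- `(q)_n = (1 - q)(1 - q²) ⋯ (1 - qⁿ)`. -/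
noncomputable def qPoch (n : ℕ) : RatFunc ℚ := ∏ i ∈ Finset.Icc 1 n, (1 - q ^ i)

/-- The Gaussian `[P; N]`, equal to `(q)_P / ((q)_N (q)_{P-N})` if `P ≥ N ≥ 0` and to `0`
otherwise. -/
noncomputable def gauss (P N : ℤ) : RatFunc ℚ :=
  if 0 ≤ N ∧ N ≤ P then qPoch P.toNat / (qPoch N.toNat * qPoch (P - N).toNat) else 0

/-! ### The bosonic side -/

/-- The `k`-th summand of the bosonic side. -/
noncomputable def bosonicTerm (p p' r s N : ℕ) (k : ℤ) : RatFunc ℚ :=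
  q ^ (k ^ 2 * p * p' + k * (p' * r - p * s)) * gauss (2 * N) (N + p * k)
    - q ^ ((k * p + r) * (k * p' + s)) * gauss (2 * N) (N + p * k + r)

/-! ### Sequences of partitions

A sequence `n⁽¹⁾, …, n⁽ˣ⁾` of partitions is a list of `x` lists of parts. All indices `k` and `i`
below are 1-based, except that `i = 0` refers to the bound `n_{k,0}`. -/

/-- `(f₁, …, f_{t+1}) = (c₁, …, c_{u-1}, d, c_u - d, c_{u+1}, …, c_t)`. -/
def fSeq (c : ℕ → ℕ) (u d k : ℕ) : ℕ :=
  if k < u then c k else if k = u then d else if k = u + 1 then c u - d else c (k - 1)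

/-- The partition `n⁽ᵏ⁾`. -/
def part (n : List (List ℕ)) (k : ℕ) : List ℕ := n.getD (k - 1) []

/-- The weight of `n⁽ᵏ⁾`. -/
def wt (n : List (List ℕ)) (k : ℕ) : ℕ := (part n k).sum

/-- The pair `(w_k, n_{k,0})` of bounds, with `w₁ = ∞` and `n_{1,0} = N`. The value at the
unused index `k = 0` is a dummy. -/
def bounds (f : ℕ → ℕ) (u N : ℕ) (n : List (List ℕ)) : ℕ → ℕ∞ × ℕ∞
  | 0 => (⊤, N)
  | 1 => (⊤, N)
  | k + 2 =>
    let w := (bounds f u N n (k + 1)).1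
    let top := (bounds f u N n (k + 1)).2
    let last : ℕ∞ :=
      if f (k + 1) = 0 then top else ((part n (k + 1)).getD (f (k + 1) - 1) 0 : ℕ)
    if k + 2 ≤ u then (last, w - (wt n (k + 1) : ℕ))
    else if k + 2 = u + 1 then (w - 1 - (wt n (k + 1) : ℕ), last + 1)
    else (last - 1, w + 1 - (wt n (k + 1) : ℕ))

/-- `w_k`. -/
def wBound (f : ℕ → ℕ) (u N : ℕ) (n : List (List ℕ)) (k : ℕ) : ℕ∞ := (bounds f u N n k).1

/-- `n_{k,i}`: the `i`-th part of `n⁽ᵏ⁾` for `i ≥ 1`, and the bound `n_{k,0}` for `i = 0`. -/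
def entry (f : ℕ → ℕ) (u N : ℕ) (n : List (List ℕ)) (k i : ℕ) : ℕ∞ :=
  if i = 0 then (bounds f u N n k).2 else ((part n k).getD (i - 1) 0 : ℕ)

/-- The sequences of partitions over which the fermionic sum is taken; here `x = n.length`. -/
structure Admissible (c : ℕ → ℕ) (t u d N : ℕ) (n : List (List ℕ)) : Prop where
  le_length : u ≤ n.length
  length_le : n.length ≤ t + 1
  length_part : ∀ k, 1 ≤ k → k ≤ n.length → (part n k).length = fSeq c u d k
  antitone : ∀ k, 1 ≤ k → k ≤ n.length → ∀ i, 1 ≤ i → i ≤ fSeq c u d k →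
    entry (fSeq c u d) u N n k i ≤ entry (fSeq c u d) u N n k (i - 1)
  wt_le : ∀ k, 1 ≤ k → k ≤ n.length → (wt n k : ℕ∞) ≤ wBound (fSeq c u d) u N n k
  wt_length : (wt n n.length : ℕ∞) = wBound (fSeq c u d) u N n n.length
  wt_lt : u < n.length → (wt n u : ℕ∞) < wBound (fSeq c u d) u N n u
  last_pos : ∀ k, u < k → k < n.length →
    0 < entry (fSeq c u d) u N n k (fSeq c u d k)
  last_eq_zero : n.length < t + 1 →
    entry (fSeq c u d) u N n n.length (fSeq c u d n.length) = 0

/-! ### The fermionic side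

In an admissible sequence every `w_k` and every `n_{k,i}` that is used below is finite. -/

/-- `n_{k,i}` as a natural number. -/
def entryNat (f : ℕ → ℕ) (u N : ℕ) (n : List (List ℕ)) (k i : ℕ) : ℕ :=
  (entry f u N n k i).toNat

/-- The exponent
`n_{u,d} + ∑_{k=1}^{u} ∑_{i=1}^{f_k} n_{k,i}² + ∑_{k=u+1}^{x} ∑_{i=1}^{f_k} n_{k,i} (n_{k,i} - 1)`. -/
def fermExponent (f : ℕ → ℕ) (u d N : ℕ) (n : List (List ℕ)) : ℕ :=
  entryNat f u N n u d
    + ∑ k ∈ Finset.Icc 1 u, ∑ i ∈ Finset.Icc 1 (f k), entryNat f u N n k i ^ 2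
    + ∑ k ∈ Finset.Icc (u + 1) n.length, ∑ i ∈ Finset.Icc 1 (f k),
        entryNat f u N n k i * (entryNat f u N n k i - 1)

/-- `∏_{i=1}^{f_k} 1 / (q)_{n_{k,i-1} - n_{k,i}}`. -/
noncomputable def invFactor (f : ℕ → ℕ) (u N : ℕ) (n : List (List ℕ)) (k : ℕ) : RatFunc ℚ :=
  ∏ i ∈ Finset.Icc 1 (f k), 1 / qPoch (entryNat f u N n k (i - 1) - entryNat f u N n k i)

/-- The product over `m ≤ k ≤ x` and `1 + δ_{m,k} ≤ i ≤ f_k` of the Gaussians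
`[2 (w_k - ∑_{j=1}^{i} n_{k,j}) + n_{k,i-1} + n_{k,i}; n_{k,i-1} - n_{k,i}]`. -/
noncomputable def gaussFactor (f : ℕ → ℕ) (u N : ℕ) (n : List (List ℕ)) (m : ℕ) : RatFunc ℚ :=
  ∏ k ∈ Finset.Icc m n.length, ∏ i ∈ Finset.Icc (1 + if k = m then 1 else 0) (f k),
    gauss
      (2 * (((wBound f u N n k).toNat : ℤ) - ∑ j ∈ Finset.Icc 1 i, (entryNat f u N n k j : ℤ))
        + entryNat f u N n k (i - 1) + entryNat f u N n k i)
      ((entryNat f u N n k (i - 1) : ℤ) - entryNat f u N n k i)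

/-- The summand of the fermionic sum for `u > 1`. -/
noncomputable def fermTerm (f : ℕ → ℕ) (u d N : ℕ) (n : List (List ℕ)) : RatFunc ℚ :=
  q ^ fermExponent f u d N n
    * (1 / qPoch (2 * entryNat f u N n 1 (f 1)))
    * invFactor f u N n 1
    * gaussFactor f u N n 2

/-- The summand of the fermionic sum for `u = 1`. -/
noncomputable def fermTermOne (f : ℕ → ℕ) (d N : ℕ) (n : List (List ℕ)) : RatFunc ℚ :=
  q ^ fermExponent f 1 d N n
    * (1 / qPoch (2 * (entryNat f 1 N n 2 (f 2) - 1)))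
    * invFactor f 1 N n 1 * invFactor f 1 N n 2
    * gaussFactor f 1 N n 3

end BurgeTree

/-!
The Burge transform multiplies by `q ^ i ^ 2` and a quotient of `q`-factorials and sums over `i`.
By the `q`-Saalschütz identity it turns the bosonic sum with parameters `(p', p, s, r)` into the one
with parameters `(p' + p, p, s + r, r)`, while exchanging the two bounds `L`, `M` of a bosonic sum
exchanges `(p', s)` with `(p, r)`. Read along the continued fraction of `(p' : p)`, each transform
therefore peels one part off a partition and each exchange passes to the next partition. After `u`
partitions the parameters `(s, r)` have come down to `(0, 1)`; there the summand telescopes, and the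
bosonic sum splits into the contribution of the sequences that stop at this level and a sum
that is transformed with the exponent `i (i - 1)` in place of `i ^ 2` along the rest of the
continued fraction.
-/

namespace BurgeTree

/-! ### Gaussian polynomials -/

theorem q_ne_zero : q ≠ 0 := RatFunc.X_ne_zero

theorem one_sub_q_pow_ne_zero {n : ℕ} (hn : n ≠ 0) : 1 - q ^ n ≠ 0 := by
  have h : (1 - Polynomial.X ^ n : Polynomial ℚ) ≠ 0 := fun h => by
    simpa [hn] using congrArg (Polynomial.eval 0) h
  simpa [q] using (map_ne_zero_iff _ (RatFunc.algebraMap_injective ℚ)).2 h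

theorem qPoch_ne_zero (n : ℕ) : qPoch n ≠ 0 :=
  Finset.prod_ne_zero_iff.2 fun _ hi =>
    one_sub_q_pow_ne_zero (Nat.one_le_iff_ne_zero.1 (Finset.mem_Icc.1 hi).1)

@[simp] theorem qPoch_zero : qPoch 0 = 1 := by simp [qPoch]

theorem qPoch_succ (n : ℕ) : qPoch (n + 1) = qPoch n * (1 - q ^ (n + 1)) :=
  Finset.prod_Icc_succ_top (by omega) _

/-- The reciprocal `1 / (q)_z` for an integer `z`, with the usual convention that it vanishes for
`z < 0`. -/
noncomputable def invPoch (z : ℤ) : RatFunc ℚ := if 0 ≤ z then (qPoch z.toNat)⁻¹ else 0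

theorem invPoch_of_neg {z : ℤ} (hz : z < 0) : invPoch z = 0 := if_neg (by omega)

theorem invPoch_natCast (n : ℕ) : invPoch n = (qPoch n)⁻¹ := by simp [invPoch]

@[simp] theorem invPoch_zero : invPoch 0 = 1 := by simp [invPoch]

theorem invPoch_sub_one (z : ℤ) : invPoch (z - 1) = (1 - q ^ z) * invPoch z := by
  rcases lt_trichotomy z 0 with hz | rfl | hz
  · rw [invPoch_of_neg hz, invPoch_of_neg (by omega), mul_zero]
  · simp [invPoch]
  · obtain ⟨n, rfl⟩ : ∃ n : ℕ, z = (n + 1 : ℕ) := ⟨(z - 1).toNat, by omega⟩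
    have := one_sub_q_pow_ne_zero n.succ_ne_zero
    have := qPoch_ne_zero n
    rw [Nat.cast_succ, add_sub_cancel_right, ← Nat.cast_succ, invPoch_natCast, invPoch_natCast,
      qPoch_succ, zpow_natCast]
    field_simp

theorem gauss_eq (P N : ℤ) : gauss P N = qPoch P.toNat * (invPoch N * invPoch (P - N)) := by
  unfold gauss invPoch
  split_ifs <;> first | omega | simp [div_eq_mul_inv, mul_comm]

theorem gauss_eq_zero {P N : ℤ} (h : N < 0 ∨ P < N) : gauss P N = 0 := if_neg (by omega)

theorem gauss_symm (P N : ℤ) : gauss P (P - N) = gauss P N := by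
  rw [gauss_eq, gauss_eq, sub_sub_cancel, mul_comm (invPoch N)]

@[simp] theorem gauss_zero_right (n : ℕ) : gauss n 0 = 1 := by
  simp [gauss, qPoch_ne_zero]

@[simp] theorem gauss_self (n : ℕ) : gauss n n = 1 := by
  simp [gauss, qPoch_ne_zero]

theorem gauss_add_one {P N : ℤ} (h : P ≠ -1 ∨ N ≠ 0) :
    gauss (P + 1) N = gauss P (N - 1) + q ^ N * gauss P N := by
  rcases lt_or_ge P 0 with hP | hP
  · rw [gauss_eq_zero (by omega), gauss_eq_zero (by omega), gauss_eq_zero (by omega)]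
    simp
  · obtain ⟨n, rfl⟩ := Int.eq_ofNat_of_zero_le hP
    have hq : q ^ (n + 1) = q ^ N * q ^ ((n : ℤ) + 1 - N) := by
      rw [← zpow_add₀ q_ne_zero, ← zpow_natCast]
      congr 1
      push_cast
      ring
    rw [gauss_eq, gauss_eq, gauss_eq, show ((n : ℤ) + 1).toNat = n + 1 by omega,
      Int.toNat_natCast, qPoch_succ, invPoch_sub_one, show (n : ℤ) - (N - 1) = n + 1 - N by ring,
      show (n : ℤ) - N = n + 1 - N - 1 by ring, invPoch_sub_one, hq]
    ring

theorem gauss_add_one' {P N : ℤ} (h : P ≠ -1 ∨ N ≠ 0) :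
    gauss (P + 1) N = gauss P N + q ^ (P + 1 - N) * gauss P (N - 1) := by
  rw [← gauss_symm, gauss_add_one (by omega), ← gauss_symm P N, ← gauss_symm P (N - 1),
    show P + 1 - N - 1 = P - N by ring, show P - (N - 1) = P + 1 - N by ring]

theorem gauss_mul_gauss (n k j : ℤ) :
    gauss n k * gauss k j = gauss n j * gauss (n - j) (k - j) := by
  by_cases h : 0 ≤ j ∧ j ≤ k ∧ k ≤ n
  · have := qPoch_ne_zero
    rw [gauss, gauss, gauss, gauss, if_pos (by omega), if_pos (by omega), if_pos (by omega),
      if_pos (by omega), sub_sub_sub_cancel_right]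
    field_simp [this]
  · have hl : gauss n k = 0 ∨ gauss k j = 0 := by
      by_cases hk : k ≤ n
      exacts [.inr (gauss_eq_zero (by omega)), .inl (gauss_eq_zero (by omega))]
    have hr : gauss n j = 0 ∨ gauss (n - j) (k - j) = 0 := by
      by_cases hj : 0 ≤ j
      exacts [.inr (gauss_eq_zero (by omega)), .inl (gauss_eq_zero (by omega))]
    rw [mul_eq_zero.2 hl, mul_eq_zero.2 hr]

/-! ### Convolutions of Gaussian polynomials -/

section FiniteSupport

variable {M : Type*} [AddCommMonoid M] {f : ℤ → M} {a b : ℤ}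

theorem support_subset_Icc (hf : ∀ j, j < a ∨ b < j → f j = 0) :
    Function.support f ⊆ ↑(Finset.Icc a b) :=
  Function.support_subset_iff'.2 fun j hj => hf j <| by
    rw [Finset.coe_Icc, Set.mem_Icc] at hj
    omega

theorem hasFiniteSupport_of_eq_zero (hf : ∀ j, j < a ∨ b < j → f j = 0) :
    Function.HasFiniteSupport f :=
  (Finset.finite_toSet _).subset (support_subset_Icc hf)

theorem finsum_eq_sum_Icc (hf : ∀ j, j < a ∨ b < j → f j = 0) :
    ∑ᶠ j, f j = ∑ j ∈ Finset.Icc a b, f j :=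
  finsum_eq_sum_of_support_subset _ (support_subset_Icc hf)

theorem finsum_comm_of_eq_zero {f : ℤ → ℤ → M} (hf : ∀ i, i < a ∨ b < i → ∀ j, f i j = 0)
    (hfin : ∀ i, Function.HasFiniteSupport (f i)) :
    ∑ᶠ j, ∑ᶠ i, f i j = ∑ᶠ i, ∑ᶠ j, f i j := by
  rw [finsum_congr fun j => finsum_eq_sum_Icc fun i hi => hf i hi j,
    finsum_sum_comm _ (fun j i => f i j) fun i _ => hfin i]
  refine (finsum_eq_sum_Icc fun i hi => ?_).symm
  rw [finsum_congr (hf i hi), finsum_zero]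

theorem finsum_eq_sum_range {n : ℕ} (hf : ∀ j : ℤ, j < 0 ∨ n < j → f j = 0) :
    ∑ᶠ j, f j = ∑ i ∈ Finset.range (n + 1), f i := by
  rw [finsum_eq_sum_of_support_subset (s := (Finset.range (n + 1)).map Nat.castEmbedding),
    Finset.sum_map]
  · rfl
  · refine (support_subset_Icc hf).trans fun j hj => ?_
    rw [Finset.coe_Icc, Set.mem_Icc] at hj
    simp only [Finset.coe_map, Nat.castEmbedding_apply, Finset.coe_range, Set.mem_image,
      Set.mem_Iio]
    exact ⟨j.toNat, by omega, by omega⟩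

end FiniteSupport

theorem hasFiniteSupport_gauss_mul (P c : ℤ) (f : ℤ → RatFunc ℚ) :
    Function.HasFiniteSupport fun j => gauss P (j - c) * f j :=
  hasFiniteSupport_of_eq_zero (a := c) (b := P + c) fun j hj => by
    rw [gauss_eq_zero (by omega), zero_mul]

/-- Applied to `F m n = [x + m; n]` this is the `q`-Vandermonde convolution, and applied to
`F m n = 1 / (q)_n` it is Durfee's identity. -/
theorem eq_finsum_gauss_mul_of_pascal {F : ℕ → ℤ → RatFunc ℚ}
    (hF : ∀ m n, F (m + 1) n = F m (n - 1) + q ^ n * F m n) (m : ℕ) (n : ℤ) :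
    F m n = ∑ᶠ j : ℤ, gauss m j * (q ^ ((m - j) * (n - j)) * F 0 (n - j)) := by
  induction m generalizing n with
  | zero =>
    rw [finsum_eq_single _ 0 fun j hj => by rw [gauss_eq_zero (by omega), zero_mul],
      show gauss (0 : ℕ) 0 = 1 from gauss_self 0]
    simp
  | succ m ih =>
    let g (j : ℤ) : RatFunc ℚ := q ^ ((m + 1 - j) * (n - j)) * F 0 (n - j)
    have hshift : F m (n - 1) = ∑ᶠ j, gauss m (j - 1) * g j := by
      rw [ih, ← finsum_comp_equiv (Equiv.subRight (1 : ℤ))]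
      refine finsum_congr fun j => ?_
      rw [Equiv.subRight_apply, sub_sub_sub_cancel_right, sub_sub_eq_add_sub]
    have hscale : q ^ n * F m n = ∑ᶠ j, gauss m (j - 0) * (q ^ j * g j) := by
      rw [ih, mul_finsum]
      refine finsum_congr fun j => ?_
      have : q ^ n * q ^ ((m - j) * (n - j)) = q ^ j * q ^ ((m + 1 - j) * (n - j)) := by
        rw [← zpow_add₀ q_ne_zero, ← zpow_add₀ q_ne_zero]
        ring_nf
      rw [sub_zero]
      linear_combination gauss m j * F 0 (n - j) * this
    rw [hF, hshift, hscale, ← finsum_add_distrib (hasFiniteSupport_gauss_mul m 1 g)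
      (hasFiniteSupport_gauss_mul m 0 _)]
    refine finsum_congr fun j => ?_
    rw [Nat.cast_succ, gauss_add_one (.inl (by omega)), sub_zero]
    ring

theorem gauss_add (m n : ℕ) (k : ℤ) :
    gauss (n + m) k =
      ∑ᶠ j : ℤ, gauss m j * (q ^ ((m - j) * (k - j)) * gauss n (k - j)) := by
  refine (eq_finsum_gauss_mul_of_pascal (F := fun m k => gauss (n + m) k) (fun m k => ?_) m k).trans
    (by simp)
  rw [Nat.cast_succ, ← add_assoc, gauss_add_one (.inl (by omega))]

theorem gauss_add' (m n : ℕ) (k : ℤ) :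
    gauss (m + n) k = ∑ᶠ j : ℤ, gauss m j * (q ^ (j * (n - k + j)) * gauss n (k - j)) := by
  rw [gauss_add, ← finsum_comp_equiv (Equiv.subLeft k)]
  refine finsum_congr fun j => ?_
  rw [Equiv.subLeft_apply, sub_sub_cancel, sub_sub_eq_add_sub, add_sub_right_comm, mul_comm j]
  ring

theorem invPoch_eq_finsum (m : ℕ) (n : ℤ) :
    invPoch n = ∑ᶠ j : ℤ, gauss m j * (q ^ ((m - j) * (n - j)) * invPoch (n - j)) :=
  eq_finsum_gauss_mul_of_pascal (F := fun _ n => invPoch n)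
    (fun _ n => by rw [invPoch_sub_one]; ring) m n

theorem gauss_mul_gauss_eq_finsum_expand (x y n : ℕ) (k : ℤ) :
    gauss (x + y + k) k * gauss x (n - k) =
      ∑ᶠ j : ℤ, gauss (y + n) j *
        (q ^ (j * (x - n + j)) * gauss x (n - j) * gauss (n - j) (k - j)) := by
  have hterm (j : ℤ) : gauss (y + n) j *
      (q ^ (j * (x - n + j)) * gauss x (n - j) * gauss (n - j) (k - j)) =
      gauss x (n - k) *
        (gauss (y + n) j * (q ^ (j * (x - n + j)) * gauss (x - n + k) (k - j))) := by
    have h := gauss_mul_gauss x (n - j) (n - k)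
    rw [← gauss_symm (n - j), sub_sub_sub_cancel_left, ← sub_add] at h
    linear_combination gauss (y + n) j * q ^ (j * (x - n + j)) * h
  rw [finsum_congr hterm, ← mul_finsum]
  rcases lt_or_ge ((x : ℤ) - n + k) 0 with hk | hk
  · rw [gauss_eq_zero (P := x) (by omega), mul_zero, zero_mul]
  · obtain ⟨z, hz⟩ := Int.eq_ofNat_of_zero_le hk
    have h := gauss_add' (y + n) z k
    rw [← hz, Nat.cast_add] at h
    rw [mul_comm, show (x : ℤ) + y + k = y + n + (x - n + k) by ring, h]
    refine congrArg _ (finsum_congr fun j => ?_)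
    rw [add_sub_cancel_right]

theorem gauss_mul_gauss_eq_mul_finsum (x y n : ℕ) (m j : ℤ) :
    gauss x (n - j) * gauss (y + n - j) (m - j) = gauss x (n - j) *
      ∑ᶠ k : ℤ, gauss (n - j) (k - j) * (q ^ ((n - k) * (m - k)) * gauss y (m - k)) := by
  rcases lt_or_ge (n : ℤ) j with hj | hj
  · rw [gauss_eq_zero (P := x) (by omega), zero_mul, zero_mul]
  · obtain ⟨z, hz⟩ := Int.eq_ofNat_of_zero_le (sub_nonneg.2 hj)
    have h := gauss_add z y (m - j)
    rw [← finsum_comp_equiv (Equiv.subRight j), ← hz, ← add_sub_assoc] at h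
    rw [h]
    refine congrArg _ (finsum_congr fun k => ?_)
    rw [Equiv.subRight_apply, sub_sub_sub_cancel_right, sub_sub_sub_cancel_right]

/-- The `q`-Saalschütz summation. Expanding `[x + y + k; k]` and exchanging the two sums reduces it
to two `q`-Vandermonde convolutions. -/
theorem gauss_mul_gauss_eq_finsum (x y n m : ℕ) :
    gauss (x + m) n * gauss (y + n) m =
      ∑ᶠ k : ℤ, q ^ ((n - k) * (m - k)) *
        (gauss (x + y + k) k * gauss x (n - k) * gauss y (m - k)) := by
  let c (j : ℤ) : RatFunc ℚ := gauss (y + n) j * (q ^ (j * (x - n + j)) * gauss x (n - j))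
  let g (k : ℤ) : RatFunc ℚ := q ^ ((n - k) * (m - k)) * gauss y (m - k)
  have hleft : gauss (x + m) n * gauss (y + n) m =
      ∑ᶠ j : ℤ, ∑ᶠ k : ℤ, gauss (n - j) (k - j) * (c j * g k) := by
    rw [add_comm (x : ℤ), gauss_add', mul_comm, mul_finsum]
    refine finsum_congr fun j => ?_
    rw [finsum_congr fun k => mul_left_comm _ (c j) _, ← mul_finsum]
    linear_combination q ^ (j * (x - n + j)) * gauss x (n - j) * gauss_mul_gauss (y + n) m j +
      gauss (y + n) j * q ^ (j * (x - n + j)) * gauss_mul_gauss_eq_mul_finsum x y n m j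
  rw [hleft, ← finsum_comm_of_eq_zero (a := 0) (b := y + n)]
  · refine finsum_congr fun k => ?_
    rw [gauss_mul_gauss_eq_finsum_expand, mul_comm _ (gauss y _), ← mul_assoc, mul_finsum]
    refine finsum_congr fun j => ?_
    ring
  · intro j hj k
    simp only [c]
    rw [gauss_eq_zero (P := y + n) (by omega), zero_mul, zero_mul, mul_zero]
  · exact fun j => hasFiniteSupport_gauss_mul _ _ _

/-! ### The Burge transform -/

/-- The kernel `[L + M + a - b; M - b] [L + M - a + b; M + b]` of the Burge transform for two bounds
`L`, `M`. If `L` or `M` is infinite, it stands for the limit divided by the appropriate power of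
`(q)_∞`; the value at `L = M = ∞` is a dummy. -/
noncomputable def gaussPair (L M : ℕ∞) (a b : ℤ) : RatFunc ℚ :=
  if L = ⊤ then invPoch (M.toNat - b) * invPoch (M.toNat + b)
  else if M = ⊤ then invPoch (L.toNat - a) * invPoch (L.toNat + a)
  else gauss (L.toNat + M.toNat + a - b) (M.toNat - b) *
    gauss (L.toNat + M.toNat - a + b) (M.toNat + b)

theorem gaussPair_top_left (M : ℕ) (a b : ℤ) :
    gaussPair ⊤ M a b = invPoch (M - b) * invPoch (M + b) := by simp [gaussPair]

theorem gaussPair_top_right (L : ℕ) (a b : ℤ) :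
    gaussPair L ⊤ a b = invPoch (L - a) * invPoch (L + a) := by simp [gaussPair]

theorem gaussPair_natCast (L M : ℕ) (a b : ℤ) :
    gaussPair L M a b = gauss (L + M + a - b) (M - b) * gauss (L + M - a + b) (M + b) := by
  simp [gaussPair]

theorem gaussPair_natCast_sub {L i : ℕ} (hi : i ≤ L) (a b : ℤ) :
    gaussPair (L - i : ℕ∞) i a b = gauss (L + a - b) (i - b) * gauss (L - a + b) (i + b) := by
  rw [← ENat.natCast_sub, gaussPair_natCast, Nat.cast_sub hi, sub_add_cancel]

theorem gaussPair_neg (L M : ℕ∞) (a b : ℤ) : gaussPair L M (-a) (-b) = gaussPair L M a b := by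
  unfold gaussPair
  split_ifs <;> rw [mul_comm] <;> simp [sub_eq_add_neg]

theorem gaussPair_swap {L M : ℕ∞} (h : L ≠ ⊤ ∨ M ≠ ⊤) (a b : ℤ) :
    gaussPair L M a b = gaussPair M L b a := by
  cases L <;> cases M
  · simp at h
  · rw [gaussPair_top_left, gaussPair_top_right]
  · rw [gaussPair_top_left, gaussPair_top_right]
  · rw [gaussPair_natCast, gaussPair_natCast, ← gauss_symm, mul_comm,
      ← gauss_symm _ (_ + b)]
    congr 2 <;> ring

theorem gaussPair_eq_zero_right {L : ℕ∞} {M : ℕ} {a b : ℤ} (h : M < |b|) :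
    gaussPair L M a b = 0 := by
  have hb : (M : ℤ) - b < 0 ∨ (M : ℤ) + b < 0 := by
    rcases lt_abs.1 h with h | h <;> omega
  cases L
  · rw [gaussPair_top_left]
    rcases hb with hb | hb <;> simp only [invPoch_of_neg hb, zero_mul, mul_zero]
  · rw [gaussPair_natCast]
    rcases hb with hb | hb <;> simp only [gauss_eq_zero (.inl hb), zero_mul, mul_zero]

theorem gaussPair_eq_zero_left {L : ℕ} {M : ℕ∞} {a b : ℤ} (h : L < |a|) :
    gaussPair L M a b = 0 := by
  rw [gaussPair_swap (.inl (ENat.natCast_ne_top L)), gaussPair_eq_zero_right h]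

/-- The coefficient `[2L + M - i; M - i]` of the Burge transform for two bounds `L`, `M`. If `L` or
`M` is infinite, it stands for the limit divided by the appropriate power of `(q)_∞`. -/
noncomputable def burgeCoeff (L M : ℕ∞) (i : ℕ) : RatFunc ℚ :=
  if L = ⊤ then invPoch (M.toNat - i)
  else if M = ⊤ then invPoch (2 * L.toNat)
  else gauss (2 * L.toNat + M.toNat - i) (M.toNat - i)

theorem burgeCoeff_top_left (M i : ℕ) : burgeCoeff ⊤ M i = invPoch (M - i) := by simp [burgeCoeff]

theorem burgeCoeff_top_right (L i : ℕ) : burgeCoeff L ⊤ i = invPoch (2 * L) := by simp [burgeCoeff]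

theorem burgeCoeff_natCast (L M i : ℕ) :
    burgeCoeff L M i = gauss (2 * L + M - i) (M - i) := by simp [burgeCoeff]

/-- The range `0 ≤ i ≤ min L M` of summation of the Burge transform for two bounds `L`, `M`, not
both infinite. -/
noncomputable def burgeRange (L M : ℕ∞) : Finset ℕ := Finset.range ((min L M).toNat + 1)

theorem mem_burgeRange {L M : ℕ∞} (h : L ≠ ⊤ ∨ M ≠ ⊤) {i : ℕ} :
    i ∈ burgeRange L M ↔ (i : ℕ∞) ≤ L ∧ (i : ℕ∞) ≤ M := by
  have hmin : min L M ≠ ⊤ := by simpa [min_eq_top, or_iff_not_imp_left] using h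
  rw [burgeRange, Finset.mem_range, Nat.lt_succ_iff, ← le_min_iff, ← ENat.natCast_le_natCast,
    ENat.natCast_toNat hmin]

theorem finsum_invPoch_mul (M : ℕ) (b : ℤ) :
    ∑ᶠ i : ℤ, q ^ i ^ 2 * (invPoch (M - i) * (invPoch (i - b) * invPoch (i + b))) =
      q ^ b ^ 2 * (invPoch (M - b) * invPoch (M + b)) := by
  rcases lt_or_ge (M : ℤ) b with hb | hb
  · rw [invPoch_of_neg (sub_neg.2 hb), zero_mul, mul_zero]
    refine finsum_eq_zero_of_forall_eq_zero fun i => ?_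
    rcases lt_or_ge (M : ℤ) i with hi | hi
    · rw [invPoch_of_neg (sub_neg.2 hi), zero_mul, mul_zero]
    · rw [invPoch_of_neg (z := i - b) (by omega), zero_mul, mul_zero, mul_zero]
  · obtain ⟨m, hm⟩ := Int.eq_ofNat_of_zero_le (sub_nonneg.2 hb)
    rw [invPoch_eq_finsum m (M + b), ← finsum_comp_equiv (Equiv.subLeft (M : ℤ)), ← mul_assoc,
      mul_finsum]
    refine finsum_congr fun i => ?_
    have hq : q ^ (M - i) ^ 2 = q ^ b ^ 2 * q ^ ((m - i) * (M + b - i)) := by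
      rw [← zpow_add₀ q_ne_zero, ← hm]
      ring_nf
    rw [Equiv.subLeft_apply, gauss_eq, hm, invPoch_natCast, Int.toNat_natCast, sub_sub_cancel, hq,
      sub_right_comm, hm, sub_add_eq_add_sub]
    have := qPoch_ne_zero m
    field_simp

theorem finsum_gauss_mul_gauss {L : ℕ} {a b : ℤ} (h : |a - b| ≤ L) :
    ∑ᶠ i : ℤ, q ^ i ^ 2 * (gauss (L + a - b) (i - b) * gauss (L - a + b) (i + b)) =
      q ^ b ^ 2 * gauss (2 * L) (L - (a + b)) := by
  obtain ⟨x, hx⟩ := Int.eq_ofNat_of_zero_le (show 0 ≤ (L : ℤ) + a - b by have := abs_le.1 h; omega)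
  obtain ⟨y, hy⟩ := Int.eq_ofNat_of_zero_le (show 0 ≤ (L : ℤ) - a + b by have := abs_le.1 h; omega)
  rw [hx, hy, show (2 * L : ℤ) = x + y by omega, gauss_add y x,
    ← finsum_comp_equiv (Equiv.subLeft (L - a)), mul_finsum]
  refine finsum_congr fun i => ?_
  have hq : q ^ (L - a - i) ^ 2 = q ^ b ^ 2 * q ^ ((y - i) * (L - (a + b) - i)) := by
    rw [← zpow_add₀ q_ne_zero, ← hy]
    ring_nf
  rw [Equiv.subLeft_apply, hq, ← gauss_symm y i, show (L : ℤ) - a - i + b = y - i by omega,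
    show (L : ℤ) - a - i - b = L - (a + b) - i by ring]
  ring

theorem finsum_gauss_mul_gauss_mul_gauss {L M : ℕ} {a b : ℤ} (h : |a - b| ≤ L) (hb : |b| ≤ M) :
    ∑ᶠ i : ℤ, q ^ i ^ 2 *
      (gauss (2 * L + M - i) (M - i) *
        (gauss (L + a - b) (i - b) * gauss (L - a + b) (i + b))) =
      q ^ b ^ 2 * (gauss (L + M + a) (M - b) * gauss (L + M - a) (M + b)) := by
  obtain ⟨x, hx⟩ := Int.eq_ofNat_of_zero_le (show 0 ≤ (L : ℤ) + a - b by have := abs_le.1 h; omega)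
  obtain ⟨y, hy⟩ := Int.eq_ofNat_of_zero_le (show 0 ≤ (L : ℤ) - a + b by have := abs_le.1 h; omega)
  obtain ⟨n, hn⟩ := Int.eq_ofNat_of_zero_le (show 0 ≤ (M : ℤ) - b by have := abs_le.1 hb; omega)
  obtain ⟨m, hm⟩ := Int.eq_ofNat_of_zero_le (show 0 ≤ (M : ℤ) + b by have := abs_le.1 hb; omega)
  rw [hx, hy, hn, hm, show (L + M + a : ℤ) = x + m by omega,
    show (L + M - a : ℤ) = y + n by omega, gauss_mul_gauss_eq_finsum,
    ← finsum_comp_equiv (Equiv.subLeft (M : ℤ)), mul_finsum]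
  refine finsum_congr fun i => ?_
  have hq : q ^ (M - i) ^ 2 = q ^ b ^ 2 * q ^ ((n - i) * (m - i)) := by
    rw [← zpow_add₀ q_ne_zero, ← hn, ← hm]
    ring_nf
  rw [Equiv.subLeft_apply, hq, sub_sub_cancel, show (M : ℤ) - i - b = n - i by omega,
    show (M : ℤ) - i + b = m - i by omega, show (2 * L + M - (M - i) : ℤ) = x + y + i by omega]
  ring

theorem sum_burgeCoeff_mul_gaussPair_top_left (M : ℕ) (a : ℤ) {b : ℤ} (hb : 0 ≤ b) :
    ∑ i ∈ burgeRange ⊤ M, q ^ i ^ 2 * (burgeCoeff ⊤ M i * gaussPair ⊤ i a b) =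
      q ^ b ^ 2 * gaussPair ⊤ M (a + b) b := by
  rw [gaussPair_top_left, ← finsum_invPoch_mul, finsum_eq_sum_range (n := M)]
  · simp only [burgeRange, min_top_left, ENat.toNat_natCast, burgeCoeff_top_left,
      gaussPair_top_left]
    norm_cast
  · rintro i (hi | hi)
    · rw [invPoch_of_neg (z := i - b) (by omega), zero_mul, mul_zero, mul_zero]
    · rw [invPoch_of_neg (sub_neg.2 hi), zero_mul, mul_zero]

theorem sum_burgeCoeff_mul_gaussPair_eq_zero {L : ℕ} {M : ℕ∞} {a b : ℤ} (ha : 0 ≤ a)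
    (h : L < a + b ∨ M < b.toNat) :
    ∑ i ∈ burgeRange L M, q ^ i ^ 2 * (burgeCoeff L M i * gaussPair (L - i : ℕ∞) i a b) = 0 := by
  refine Finset.sum_eq_zero fun i hi => ?_
  obtain ⟨hiL, hiM⟩ := (mem_burgeRange (.inl (ENat.natCast_ne_top L))).1 hi
  rw [Nat.cast_le] at hiL
  have hzero : gaussPair (L - i : ℕ∞) i a b = 0 := by
    by_cases hib : (i : ℤ) < b
    · exact gaussPair_eq_zero_right (by rwa [abs_of_pos (by omega)])
    · have hL : L < a + b := h.resolve_right fun h => by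
        have := Nat.cast_lt.1 (hiM.trans_lt h)
        omega
      rw [← ENat.natCast_sub]
      exact gaussPair_eq_zero_left (by rw [abs_of_nonneg ha]; omega)
  rw [hzero, mul_zero, mul_zero]

theorem sum_burgeCoeff_mul_gaussPair_top_right (L : ℕ) {a b : ℤ} (ha : 0 ≤ a) (hb : 0 ≤ b) :
    ∑ i ∈ burgeRange L ⊤, q ^ i ^ 2 * (burgeCoeff L ⊤ i * gaussPair (L - i : ℕ∞) i a b) =
      q ^ b ^ 2 * gaussPair L ⊤ (a + b) b := by
  by_cases hL : a + b ≤ L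
  · have hgauss : gaussPair L ⊤ (a + b) b = invPoch (2 * L) * gauss (2 * L) (L - (a + b)) := by
      rw [gaussPair_top_right, gauss_eq, show (2 * L : ℤ) = (2 * L : ℕ) by push_cast; rfl,
        Int.toNat_natCast, invPoch_natCast, inv_mul_cancel_left₀ (qPoch_ne_zero _)]
      congr 2
      push_cast
      ring
    rw [hgauss, mul_left_comm, ← finsum_gauss_mul_gauss (by rw [abs_le]; omega),
      finsum_eq_sum_range (n := L), Finset.mul_sum]
    · rw [burgeRange, min_top_right, ENat.toNat_natCast]
      refine Finset.sum_congr rfl fun i hi => ?_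
      rw [burgeCoeff_top_right, gaussPair_natCast_sub (Nat.lt_succ_iff.1 (Finset.mem_range.1 hi)),
        mul_left_comm]
      norm_cast
    · rintro i (hi | hi)
      · rw [gauss_eq_zero (N := i - b) (by omega), zero_mul, mul_zero]
      · rw [gauss_eq_zero (N := i + b) (by omega), mul_zero, mul_zero]
  · rw [sum_burgeCoeff_mul_gaussPair_eq_zero ha (.inl (not_le.1 hL)),
      gaussPair_eq_zero_left (by rw [abs_of_nonneg] <;> omega), mul_zero]

theorem sum_burgeCoeff_mul_gaussPair_natCast (L M : ℕ) {a b : ℤ} (ha : 0 ≤ a) (hb : 0 ≤ b) :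
    ∑ i ∈ burgeRange L M, q ^ i ^ 2 * (burgeCoeff L M i * gaussPair (L - i : ℕ∞) i a b) =
      q ^ b ^ 2 * gaussPair L M (a + b) b := by
  by_cases h : a + b ≤ L ∧ b ≤ M
  · rw [gaussPair_natCast, show L + M + (a + b) - b = L + M + a by ring,
      show L + M - (a + b) + b = L + M - a by ring,
      ← finsum_gauss_mul_gauss_mul_gauss (by rw [abs_le]; omega) (by rw [abs_le]; omega),
      finsum_eq_sum_range (n := min L M)]
    · rw [burgeRange, ← Nat.mono_cast.map_min, ENat.toNat_natCast]
      refine Finset.sum_congr rfl fun i hi => ?_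
      rw [burgeCoeff_natCast, gaussPair_natCast_sub (by have := Finset.mem_range.1 hi; omega)]
      norm_cast
    · rintro i hi
      rcases lt_or_ge i 0 with hi₀ | hi₀
      · rw [gauss_eq_zero (N := i - b) (by omega), zero_mul, mul_zero, mul_zero]
      rcases lt_or_ge (M : ℤ) i with hiM | hiM
      · rw [gauss_eq_zero (N := M - i) (by omega), zero_mul, mul_zero]
      · rw [gauss_eq_zero (N := i + b) (by omega), mul_zero, mul_zero, mul_zero]
  · rw [sum_burgeCoeff_mul_gaussPair_eq_zero ha]
    · by_cases hL : a + b ≤ L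
      · rw [gaussPair_eq_zero_right (by rw [abs_of_nonneg hb]; omega), mul_zero]
      · rw [gaussPair_eq_zero_left (by rw [abs_of_nonneg] <;> omega), mul_zero]
    · rw [Nat.cast_lt]
      omega

theorem sum_burgeCoeff_mul_gaussPair {L M : ℕ∞} (h : L ≠ ⊤ ∨ M ≠ ⊤) {a b : ℤ} (hab : 0 ≤ a * b) :
    ∑ i ∈ burgeRange L M, q ^ i ^ 2 * (burgeCoeff L M i * gaussPair (L - i) i a b) =
      q ^ b ^ 2 * gaussPair L M (a + b) b := by
  wlog hpos : 0 ≤ a ∧ 0 ≤ b generalizing a b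
  · have hneg : 0 ≤ -a ∧ 0 ≤ -b := by
      rcases mul_nonneg_iff.1 hab with h | h
      · exact absurd h hpos
      · omega
    have := this (a := -a) (b := -b) (by simpa using hab) hneg
    rw [← neg_add] at this
    simpa only [gaussPair_neg, neg_sq] using this
  cases L <;> cases M
  · simp at h
  · simpa only [ENat.top_sub_natCast] using sum_burgeCoeff_mul_gaussPair_top_left _ a hpos.2
  · exact sum_burgeCoeff_mul_gaussPair_top_right _ hpos.1 hpos.2
  · exact sum_burgeCoeff_mul_gaussPair_natCast _ _ hpos.1 hpos.2

/-! ### Bosonic sums -/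

theorem hasFiniteSupport_of_eq_zero_of_lt_abs {M : Type*} [Zero M] {f : ℤ → M} {P b n : ℤ}
    (hP : P ≠ 0) (hf : ∀ k, n < |k * P + b| → f k = 0) : Function.HasFiniteSupport f :=
  ((Set.finite_Icc (-n) n).preimage (f := fun k => k * P + b) fun _ _ _ _ h =>
    mul_right_cancel₀ hP (add_right_cancel h)).subset fun k hk =>
      abs_le.1 <| not_lt.1 fun hlt => hk (hf k hlt)

theorem hasFiniteSupport_mul_gaussPair {P' P : ℤ} (hP' : P' ≠ 0) (hP : P ≠ 0) {L M : ℕ∞}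
    (h : L ≠ ⊤ ∨ M ≠ ⊤) (e : ℤ → RatFunc ℚ) (a b : ℤ) :
    Function.HasFiniteSupport fun k : ℤ => e k * gaussPair L M (k * P' + a) (k * P + b) := by
  rcases h with h | h
  · lift L to ℕ using h
    exact hasFiniteSupport_of_eq_zero_of_lt_abs hP' fun k hk =>
      mul_eq_zero_of_right _ (gaussPair_eq_zero_left hk)
  · lift M to ℕ using h
    exact hasFiniteSupport_of_eq_zero_of_lt_abs hP fun k hk =>
      mul_eq_zero_of_right _ (gaussPair_eq_zero_right hk)

/-- The `k`-th summand of the bosonic sum for the bounds `L`, `M`. Up to the factor `(q)_{2N}`, the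
bounds `∞`, `N` and the parameters `p'`, `p`, `s`, `r` give `bosonicTerm p p' r s N k`. -/
noncomputable def bosTerm (P' P S R : ℤ) (L M : ℕ∞) (k : ℤ) : RatFunc ℚ :=
  q ^ (k ^ 2 * P * P' + k * (P' * R - P * S)) * gaussPair L M (k * P') (k * P)
    - q ^ ((k * P + R) * (k * P' + S)) * gaussPair L M (k * P' + S) (k * P + R)

/-- The bosonic sum for the bounds `L`, `M`. All but finitely many summands vanish if `L` or `M` is
finite and `P`, `P'` are nonzero. -/
noncomputable def bosSum (P' P S R : ℤ) (L M : ℕ∞) : RatFunc ℚ := ∑ᶠ k, bosTerm P' P S R L M k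

section

variable {P' P S R : ℤ} {L M : ℕ∞}

theorem hasFiniteSupport_bosTerm (hP' : P' ≠ 0) (hP : P ≠ 0) (h : L ≠ ⊤ ∨ M ≠ ⊤) :
    Function.HasFiniteSupport (bosTerm P' P S R L M) := by
  have hfst := hasFiniteSupport_mul_gaussPair hP' hP h
    (fun k => q ^ (k ^ 2 * P * P' + k * (P' * R - P * S))) 0 0
  simp only [add_zero] at hfst
  exact hfst.fun_sub (hasFiniteSupport_mul_gaussPair hP' hP h _ S R)

theorem bosSum_eq_sub (hP' : P' ≠ 0) (hP : P ≠ 0) (h : L ≠ ⊤ ∨ M ≠ ⊤) :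
    bosSum P' P S R L M =
      (∑ᶠ k : ℤ, q ^ (k ^ 2 * P * P' + k * (P' * R - P * S)) * gaussPair L M (k * P') (k * P)) -
      ∑ᶠ k : ℤ, q ^ ((k * P + R) * (k * P' + S)) * gaussPair L M (k * P' + S) (k * P + R) := by
  refine finsum_sub_distrib ?_ (hasFiniteSupport_mul_gaussPair hP' hP h _ S R)
  simpa only [add_zero] using hasFiniteSupport_mul_gaussPair hP' hP h _ 0 0

theorem bosSum_swap (hP' : P' ≠ 0) (hP : P ≠ 0) (h : L ≠ ⊤ ∨ M ≠ ⊤) :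
    bosSum P' P S R L M = bosSum P P' R S M L := by
  rw [bosSum_eq_sub hP' hP h, bosSum_eq_sub hP hP' h.symm]
  congr 1
  · rw [← finsum_comp_equiv (Equiv.neg ℤ)]
    refine finsum_congr fun k => ?_
    rw [Equiv.neg_apply, neg_mul k P, neg_mul k P', gaussPair_neg, gaussPair_swap h]
    ring_nf
  · refine finsum_congr fun k => ?_
    rw [gaussPair_swap h, mul_comm (k * P + R)]

theorem linear_mul_linear_nonneg (hS : 0 ≤ S) (hS' : S ≤ P') (hR : 0 ≤ R) (hR' : R ≤ P) (k : ℤ) :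
    0 ≤ (k * P' + S) * (k * P + R) := by
  rcases le_or_gt 0 k with hk | hk
  · have := hS.trans hS'
    have := hR.trans hR'
    positivity
  · exact mul_nonneg_of_nonpos_of_nonpos (by nlinarith) (by nlinarith)

theorem sum_burgeCoeff_mul_bosTerm (hS : 0 ≤ S) (hS' : S ≤ P') (hR : 0 ≤ R) (hR' : R ≤ P)
    (h : L ≠ ⊤ ∨ M ≠ ⊤) (k : ℤ) :
    ∑ i ∈ burgeRange L M, q ^ i ^ 2 * (burgeCoeff L M i * bosTerm P' P S R (L - i) i k) =
      bosTerm (P' + P) P (S + R) R L M k := by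
  have hfst := sum_burgeCoeff_mul_gaussPair h (linear_mul_linear_nonneg (S := 0) (R := 0) le_rfl
    (hS.trans hS') le_rfl (hR.trans hR') k)
  have hsnd := sum_burgeCoeff_mul_gaussPair h (linear_mul_linear_nonneg hS hS' hR hR' k)
  have hpull (e : RatFunc ℚ) (a b : ℤ) :
      ∑ i ∈ burgeRange L M, q ^ i ^ 2 * (burgeCoeff L M i * (e * gaussPair (L - i) i a b)) =
      e * ∑ i ∈ burgeRange L M, q ^ i ^ 2 * (burgeCoeff L M i * gaussPair (L - i) i a b) := by
    rw [Finset.mul_sum]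
    exact Finset.sum_congr rfl fun i _ => by ring
  simp_rw [add_zero] at hfst
  simp_rw [bosTerm, mul_sub, Finset.sum_sub_distrib, hpull, hfst, hsnd, ← mul_assoc,
    ← zpow_add₀ q_ne_zero]
  ring_nf

theorem sum_burgeCoeff_mul_bosSum (hP' : P' ≠ 0) (hP : P ≠ 0) (hS : 0 ≤ S) (hS' : S ≤ P')
    (hR : 0 ≤ R) (hR' : R ≤ P) (h : L ≠ ⊤ ∨ M ≠ ⊤) :
    ∑ i ∈ burgeRange L M, q ^ i ^ 2 * (burgeCoeff L M i * bosSum P' P S R (L - i) i) =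
      bosSum (P' + P) P (S + R) R L M := by
  simp_rw [bosSum, mul_finsum, ← sum_burgeCoeff_mul_bosTerm hS hS' hR hR' h]
  exact (finsum_sum_comm _ _ fun i _ =>
    ((hasFiniteSupport_bosTerm hP' hP (.inr (ENat.natCast_ne_top i))).mul_right _).mul_right _).symm

theorem bosSum_one (h : L ≠ ⊤ ∨ M ≠ ⊤) : bosSum 1 1 1 1 L M = 0 := by
  rw [bosSum_eq_sub one_ne_zero one_ne_zero h, sub_eq_zero,
    ← finsum_comp_equiv (Equiv.addRight (1 : ℤ))]
  refine finsum_congr fun k => ?_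
  simp only [Equiv.coe_addRight, mul_one]
  ring_nf

theorem bosTerm_zero_one (k : ℤ) :
    bosTerm P' P 0 1 L M k = q ^ (k * P' * (k * P) + k * P') *
      (gaussPair L M (k * P') (k * P) - gaussPair L M (k * P') (k * P + 1)) := by
  rw [bosTerm, add_zero, mul_sub]
  ring_nf

theorem bosSum_zero_one_zero (hP' : P' ≠ 0) (M : ℕ∞) :
    bosSum P' P 0 1 0 M = if M = 0 then 1 else 0 := by
  have hzero {a b : ℤ} (ha : a ≠ 0) : gaussPair 0 M a b = 0 :=
    gaussPair_eq_zero_left (L := 0) (by simpa using ha)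
  rw [bosSum, finsum_eq_single _ 0 fun k hk => by
    have ha := mul_ne_zero hk hP'
    rw [bosTerm_zero_one, hzero ha, hzero ha, sub_zero, mul_zero]]
  simp only [bosTerm_zero_one, zero_mul, add_zero, zpow_zero, one_mul, zero_add]
  cases M with
  | top =>
    rw [← Nat.cast_zero, gaussPair_top_right, gaussPair_top_right, sub_self, if_neg (by simp)]
  | coe M =>
    rw [← Nat.cast_zero, gaussPair_natCast, gaussPair_natCast]
    rcases M with _ | M
    · have h : gauss 0 0 = 1 := gauss_self 0
      simp [gauss_eq_zero (P := -1) (N := -1), h]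
    · have h := gauss_self (M + 1)
      have h' := gauss_self (M + 2)
      push_cast at h h'
      simp [h, add_assoc, one_add_one_eq_two, h']

theorem gaussPair_top_sub_gaussPair_top (M : ℕ) (a b : ℤ) :
    gaussPair ⊤ M a b - gaussPair ⊤ M a (b + 1) =
      q ^ (M - b) * gaussPair ⊤ M a b - q ^ (M + b + 1) * gaussPair ⊤ M (a + 1) (b + 1) := by
  have hminus := invPoch_sub_one (M - b)
  have hplus := invPoch_sub_one (M + b + 1)
  rw [add_sub_cancel_right] at hplus
  simp only [gaussPair_top_left, sub_add_eq_sub_sub, ← add_assoc, hminus, hplus]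
  ring

theorem gauss_mul_gauss_sub_gauss_mul_gauss {X Y m n : ℤ} (hX : X ≠ -1 ∨ m ≠ 0)
    (hY : Y ≠ -1 ∨ n ≠ 0 ∧ n ≠ -1) (hY' : Y ≠ -2 ∨ n ≠ -1) :
    gauss (X + 1) m * gauss (Y + 1) n - gauss X (m - 1) * gauss (Y + 1 + 1) (n + 1) =
      q ^ m * (gauss X m * gauss Y n) - q ^ (n + 1) * (gauss X (m - 1) * gauss Y (n + 1)) +
        (q ^ (m - n + Y + 1) * (gauss X m * gauss Y (n - 1)) -
          q ^ (Y + 1) * (gauss Y n * gauss X (m - 1))) := by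
  have hn := gauss_add_one' (P := Y) (N := n) (by omega)
  have hn1 := gauss_add_one' (P := Y) (N := n + 1) (by omega)
  have hq : q ^ (m - n + Y + 1) = q ^ m * q ^ (Y + 1 - n) := by
    rw [← zpow_add₀ q_ne_zero]
    ring_nf
  have hq1 : q ^ (Y + 1) = q ^ (n + 1) * q ^ (Y + 1 - (n + 1)) := by
    rw [← zpow_add₀ q_ne_zero]
    ring_nf
  rw [gauss_add_one hX, gauss_add_one (P := Y + 1) (by omega), hn1, add_sub_cancel_right, hn, hq,
    hq1]
  ring

theorem gaussPair_succ_sub_gaussPair_succ (L M : ℕ) {a b : ℤ}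
    (h : a = 0 ∧ b = 0 ∨ 0 < a ∧ 0 < b ∨ a < 0 ∧ b < 0) :
    gaussPair (L + 1 : ℕ) M a b - gaussPair (L + 1 : ℕ) M a (b + 1) =
      q ^ (M - b) * gaussPair L M a b - q ^ (M + b + 1) * gaussPair L M (a + 1) (b + 1) +
        (q ^ (L + M + 1 - a - b) *
            (gauss (L + M + a - b) (M - b) * gauss (L + M - a + b) (M + b - 1)) -
          q ^ (L + M + 1 - a + b) *
            (gauss (L + M - a + b) (M + b) * gauss (L + M + a - b) (M - b - 1))) := by
  have hpascal := gauss_mul_gauss_sub_gauss_mul_gauss (X := L + M + a - b) (Y := L + M - a + b)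
    (m := M - b) (n := M + b) (by omega) (by omega) (by omega)
  simp only [gaussPair_natCast]
  push_cast
  ring_nf at hpascal ⊢
  exact hpascal

/-- The summands that cancel in pairs under `k ↦ -k` when the Pascal recurrences are applied to
`bosSum P' P 0 1 (L + 1) M`; see `bosSum_zero_one`. -/
noncomputable def flipTerm (P' P : ℤ) (L M : ℕ) (k : ℤ) : RatFunc ℚ :=
  q ^ (L + M + 1 + k * P' * (k * P) - k * P) *
    (gauss (L + M + k * P' - k * P) (M - k * P) *
      gauss (L + M - k * P' + k * P) (M + k * P - 1))

theorem hasFiniteSupport_flipTerm (hP : P ≠ 0) (L M : ℕ) :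
    Function.HasFiniteSupport (flipTerm P' P L M) := by
  refine hasFiniteSupport_of_eq_zero_of_lt_abs (b := 0) (n := M) hP fun k hk => ?_
  rcases lt_abs.1 hk with h | h
  · rw [flipTerm, gauss_eq_zero (N := M - k * P) (by omega), zero_mul, mul_zero]
  · rw [flipTerm, gauss_eq_zero (N := M + k * P - 1) (by omega), mul_zero, mul_zero]

theorem finsum_flipTerm_sub_flipTerm_neg (hP : P ≠ 0) (L M : ℕ) :
    ∑ᶠ k, (flipTerm P' P L M k - flipTerm P' P L M (-k)) = 0 := by
  have hfin := hasFiniteSupport_flipTerm (P' := P') hP L M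
  exact (finsum_sub_distrib hfin (hfin.preimage (Equiv.neg ℤ).injective.injOn)).trans
    (sub_eq_zero.2 (finsum_comp_equiv (Equiv.neg ℤ)).symm)

theorem bosTerm_zero_one_top (M : ℕ) (k : ℤ) :
    bosTerm P' P 0 1 ⊤ M k = q ^ M * bosTerm P' P 1 1 ⊤ M k := by
  rw [bosTerm_zero_one, gaussPair_top_sub_gaussPair_top, bosTerm, mul_sub, mul_sub]
  simp only [← mul_assoc, ← zpow_natCast q, ← zpow_add₀ q_ne_zero]
  ring_nf

theorem bosTerm_zero_one_natCast (hP' : 0 < P') (hP : 0 < P) (L M : ℕ) (k : ℤ) :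
    bosTerm P' P 0 1 (L + 1 : ℕ) M k = q ^ M * bosTerm P' P 1 1 L M k +
      (flipTerm P' P L M k - flipTerm P' P L M (-k)) := by
  have hsign : (k * P' = 0 ∧ k * P = 0) ∨ (0 < k * P' ∧ 0 < k * P) ∨ (k * P' < 0 ∧ k * P < 0) := by
    rcases lt_trichotomy k 0 with hk | rfl | hk
    · exact .inr (.inr ⟨mul_neg_of_neg_of_pos hk hP', mul_neg_of_neg_of_pos hk hP⟩)
    · simp
    · exact .inr (.inl ⟨mul_pos hk hP', mul_pos hk hP⟩)
  rw [bosTerm_zero_one, gaussPair_succ_sub_gaussPair_succ L M hsign, bosTerm]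
  simp only [flipTerm, mul_add, mul_sub, ← mul_assoc, ← zpow_natCast q, ← zpow_add₀ q_ne_zero]
  ring_nf

theorem bosSum_zero_one (hP' : 0 < P') (hP : 0 < P) (L : ℕ∞) (M : ℕ) :
    bosSum P' P 0 1 (L + 1) M = q ^ M * bosSum P' P 1 1 L M := by
  rw [bosSum, bosSum, mul_finsum]
  cases L with
  | top => exact finsum_congr fun k => bosTerm_zero_one_top M k
  | coe L =>
    have hflip := hasFiniteSupport_flipTerm (P' := P') hP.ne' L M
    rw [← Nat.cast_succ, finsum_congr fun k => bosTerm_zero_one_natCast hP' hP L M k,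
      finsum_add_distrib, finsum_flipTerm_sub_flipTerm_neg hP.ne', add_zero]
    · exact (hasFiniteSupport_bosTerm hP'.ne' hP.ne' (.inl (ENat.natCast_ne_top L))).mul_right _
    · exact hflip.fun_sub (hflip.preimage (Equiv.neg ℤ).injective.injOn)

/-- The sum over the partitions beyond the branching level, as a function of the bounds of the first
of them. For `M = n + 1` it is a bosonic sum for the bounds `L`, `n`; for `M = 0` the only choice is
to stop at once, with the empty partition of weight `L = 0`. -/
noncomputable def tailSum (P' P : ℤ) (L M : ℕ∞) : RatFunc ℚ :=
  if M = 0 then (if L = 0 then 1 else 0) else bosSum P' P 1 1 L (M - 1)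

theorem tailSum_zero_right : tailSum P' P L 0 = if L = 0 then 1 else 0 := if_pos rfl

theorem tailSum_add_one (L M : ℕ∞) : tailSum P' P L (M + 1) = bosSum P' P 1 1 L M := by
  rw [tailSum, if_neg (by simp),
    (ENat.addLECancellable_of_ne_top ENat.one_ne_top).add_tsub_cancel_right]

theorem burgeCoeff_zero_left (M : ℕ∞) : burgeCoeff 0 M 0 = 1 := by
  cases M with
  | top => simpa using burgeCoeff_top_right 0 0
  | coe M => simpa using burgeCoeff_natCast 0 M 0

theorem burgeCoeff_zero_right (L : ℕ∞) : burgeCoeff L 0 0 = 1 := by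
  cases L with
  | top => simpa using burgeCoeff_top_left 0 0
  | coe L => simpa using (burgeCoeff_natCast L 0 0).trans (by simpa using gauss_zero_right (2 * L))

theorem burgeCoeff_add_one (h : L ≠ ⊤ ∨ M ≠ ⊤) (i : ℕ) :
    burgeCoeff L (M + 1) (i + 1) = burgeCoeff L M i := by
  cases M with
  | top =>
    lift L to ℕ using by simpa using h
    rw [top_add, burgeCoeff_top_right, burgeCoeff_top_right]
  | coe M =>
    rw [← Nat.cast_succ]
    cases L with
    | top => rw [burgeCoeff_top_left, burgeCoeff_top_left]; congr 1; push_cast; ring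
    | coe L => rw [burgeCoeff_natCast, burgeCoeff_natCast]; congr 1 <;> push_cast <;> ring

theorem burgeRange_zero_left (M : ℕ∞) : burgeRange 0 M = {0} := by simp [burgeRange]

theorem burgeRange_zero_right (L : ℕ∞) : burgeRange L 0 = {0} := by simp [burgeRange]

theorem burgeCoeff_mul_tailSum_add_one (hP' : 0 < P') (hP : 0 < P) (h : L ≠ ⊤ ∨ M ≠ ⊤) {j : ℕ}
    (hj : j < L) :
    q ^ ((j + 1) * j) * (burgeCoeff L (M + 1) (j + 1) * tailSum P' P (L - (j + 1)) (j + 1)) =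
      q ^ j ^ 2 * (burgeCoeff L M j * bosSum P' P 0 1 (L - j) j) := by
  rw [burgeCoeff_add_one h]
  obtain ⟨k, rfl⟩ := exists_add_of_le (Order.add_one_le_of_lt hj)
  rw [← Nat.cast_succ, (ENat.addLECancellable_natCast _).add_tsub_cancel_left, Nat.cast_succ,
    add_assoc, (ENat.addLECancellable_natCast _).add_tsub_cancel_left, add_comm 1 k,
    bosSum_zero_one hP' hP, tailSum_add_one]
  ring

theorem sum_burgeCoeff_mul_tailSum_add_one (hP' : 0 < P') (hP : 0 < P) (h : L ≠ ⊤ ∨ M ≠ ⊤)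
    (hL : L ≠ 0) :
    ∑ i ∈ burgeRange L (M + 1),
        q ^ (i * (i - 1)) * (burgeCoeff L (M + 1) i * tailSum P' P (L - i) i) =
      ∑ i ∈ burgeRange L M, q ^ i ^ 2 * (burgeCoeff L M i * bosSum P' P 0 1 (L - i) i) := by
  have hzero : tailSum P' P (L - (0 : ℕ)) (0 : ℕ) = 0 := by
    rw [Nat.cast_zero, tailSum_zero_right, tsub_zero, if_neg hL]
  rw [burgeRange, burgeRange, Finset.sum_range_succ', hzero, mul_zero, mul_zero, add_zero]
  simp only [Nat.cast_succ, Nat.add_sub_cancel]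
  rcases lt_or_ge M L with hML | hLM
  · lift M to ℕ using hML.ne_top
    rw [min_eq_right (Order.add_one_le_of_lt hML), min_eq_right hML.le, ← Nat.cast_succ,
      ENat.toNat_natCast, ENat.toNat_natCast]
    exact Finset.sum_congr rfl fun j hj => burgeCoeff_mul_tailSum_add_one hP' hP h <|
      (Nat.cast_le.2 (Nat.lt_succ_iff.1 (Finset.mem_range.1 hj))).trans_lt hML
  · lift L to ℕ using h.elim id fun hM => ne_top_of_le_ne_top hM hLM
    rw [min_eq_left hLM, min_eq_left (hLM.trans le_self_add), ENat.toNat_natCast,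
      Finset.sum_range_succ, tsub_self, bosSum_zero_one_zero hP'.ne', if_neg hL, mul_zero, mul_zero,
      add_zero]
    exact Finset.sum_congr rfl fun j hj => burgeCoeff_mul_tailSum_add_one hP' hP h <|
      Nat.cast_lt.2 (Finset.mem_range.1 hj)

theorem sum_burgeCoeff_mul_tailSum (hP' : 0 < P') (hP : 0 < P) (h : L ≠ ⊤ ∨ M ≠ ⊤) :
    ∑ i ∈ burgeRange L M, q ^ (i * (i - 1)) * (burgeCoeff L M i * tailSum P' P (L - i) i) =
      tailSum (P' + P) P L M := by
  rcases eq_or_ne M 0 with rfl | hM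
  · simp [burgeRange_zero_right, burgeCoeff_zero_right, tailSum_zero_right]
  obtain ⟨M, rfl⟩ := exists_add_of_le (Order.one_le_iff_ne_zero.2 hM)
  rw [add_comm 1 M] at h ⊢
  replace h : L ≠ ⊤ ∨ M ≠ ⊤ := by simpa using h
  have hburge := sum_burgeCoeff_mul_bosSum hP'.ne' hP.ne' le_rfl hP'.le zero_le_one hP h
  rw [zero_add] at hburge
  rw [tailSum_add_one, ← hburge]
  rcases eq_or_ne L 0 with rfl | hL
  · simp [burgeRange_zero_left, burgeCoeff_zero_left, tailSum_zero_right,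
      bosSum_zero_one_zero hP'.ne']
  · exact sum_burgeCoeff_mul_tailSum_add_one hP' hP h hL

theorem tailSum_swap (hP' : P' ≠ 0) (hP : P ≠ 0) (h : L ≠ ⊤ ∨ M ≠ ⊤) :
    tailSum P P' M (L + 1) = tailSum P' P L (M + 1) := by
  rw [tailSum_add_one, tailSum_add_one, bosSum_swap hP' hP h]

theorem tailSum_two_one (h : L ≠ ⊤ ∨ M ≠ ⊤) : tailSum 2 1 L M = if L = 0 then 1 else 0 := by
  have hsucc (i : ℕ) (hi : i ≠ 0) : tailSum 1 1 (L - i) i = 0 := by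
    obtain ⟨j, rfl⟩ := Nat.exists_eq_succ_of_ne_zero hi
    rw [Nat.cast_succ, tailSum_add_one, bosSum_one (.inr (ENat.natCast_ne_top j))]
  rw [← one_add_one_eq_two, ← sum_burgeCoeff_mul_tailSum one_pos one_pos h,
    Finset.sum_eq_single 0 (fun i _ hi => by rw [hsucc i hi, mul_zero, mul_zero])
      fun hmem => absurd ((mem_burgeRange h).2 (by simp)) hmem]
  rcases eq_or_ne L 0 with rfl | hL
  · simp [tailSum_zero_right, burgeCoeff_zero_left]
  · simp [tailSum_zero_right, hL]

end

/-! ### Sums over partitions -/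

theorem sum_biUnion_image_cons {α M : Type*} [DecidableEq α] [AddCommMonoid M] (s : Finset α)
    (F : α → Finset (List α)) (g : List α → M) :
    ∑ l ∈ s.biUnion fun a => (F a).image (List.cons a), g l = ∑ a ∈ s, ∑ l ∈ F a, g (a :: l) := by
  rw [Finset.sum_biUnion]
  · exact Finset.sum_congr rfl fun a _ => Finset.sum_image List.cons_injective.injOn
  · intro a _ b _ hab
    rw [Function.onFun, Finset.disjoint_left]
    intro l hl hl'
    obtain ⟨_, _, rfl⟩ := Finset.mem_image.1 hl
    obtain ⟨_, _, h⟩ := Finset.mem_image.1 hl'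
    exact hab (List.cons.inj h).1.symm

/-- The parts of a partition, preceded at index `0` by its bound `top`. -/
def boundedEntry (top : ℕ∞) (P : List ℕ) (i : ℕ) : ℕ∞ :=
  if i = 0 then top else (P.getD (i - 1) 0 : ℕ)

@[simp] theorem boundedEntry_zero (top : ℕ∞) (P : List ℕ) : boundedEntry top P 0 = top := rfl

@[simp] theorem boundedEntry_cons_add_one (top : ℕ∞) (a : ℕ) (P : List ℕ) (i : ℕ) :
    boundedEntry top (a :: P) (i + 1) = boundedEntry a P i := by
  cases i <;> simp [boundedEntry]

/-- The last part of a partition, or its bound `top` if it has no parts. -/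
def lastEntry (top : ℕ∞) (P : List ℕ) : ℕ∞ := boundedEntry top P P.length

@[simp] theorem lastEntry_nil (top : ℕ∞) : lastEntry top [] = top := rfl

@[simp] theorem lastEntry_cons (top : ℕ∞) (a : ℕ) (P : List ℕ) :
    lastEntry top (a :: P) = lastEntry a P := boundedEntry_cons_add_one top a P P.length

theorem lastEntry_ne_top {top : ℕ∞} {P : List ℕ} (h : top ≠ ⊤ ∨ P ≠ []) :
    lastEntry top P ≠ ⊤ := by
  induction P generalizing top with
  | nil => simpa using h
  | cons a P ih => exact lastEntry_cons top a P ▸ ih (.inl (ENat.natCast_ne_top a))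

/-- The bounds `(w, m)` left over by a partition `P` with bounds `b` for its weight and for its
parts: `w` is the unused weight, and `m` is the last part. -/
def afterPart (b : ℕ∞ × ℕ∞) (P : List ℕ) : ℕ∞ × ℕ∞ := (b.1 - P.sum, lastEntry b.2 P)

@[simp] theorem afterPart_nil (b : ℕ∞ × ℕ∞) : afterPart b [] = b := by simp [afterPart]

@[simp] theorem afterPart_cons (b : ℕ∞ × ℕ∞) (i : ℕ) (P : List ℕ) :
    afterPart b (i :: P) = afterPart (b.1 - i, i) P := by
  simp [afterPart, tsub_add_eq_tsub_tsub]

theorem afterPart_ne_top {b : ℕ∞ × ℕ∞} (h : b.1 ≠ ⊤ ∨ b.2 ≠ ⊤) (P : List ℕ) :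
    (afterPart b P).1 ≠ ⊤ ∨ (afterPart b P).2 ≠ ⊤ :=
  h.imp (fun h => ne_top_of_le_ne_top h tsub_le_self) fun h => lastEntry_ne_top (.inl h)

/-- The partitions with `f` parts (possibly zero), each at most `b.2`, of weight at most `b.1`. -/
noncomputable def boundedParts : ℕ → ℕ∞ × ℕ∞ → Finset (List ℕ)
  | 0, _ => {[]}
  | f + 1, b => (burgeRange b.1 b.2).biUnion fun i =>
      (boundedParts f (b.1 - i, i)).image (List.cons i)

theorem mem_boundedParts_cons {f : ℕ} {b : ℕ∞ × ℕ∞} (h : b.1 ≠ ⊤ ∨ b.2 ≠ ⊤) {i : ℕ}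
    {P : List ℕ} :
    i :: P ∈ boundedParts (f + 1) b ↔
      ((i : ℕ∞) ≤ b.1 ∧ (i : ℕ∞) ≤ b.2) ∧ P ∈ boundedParts f (b.1 - i, i) := by
  simp only [boundedParts, Finset.mem_biUnion, Finset.mem_image, List.cons.injEq, mem_burgeRange h]
  aesop

theorem mem_boundedParts {f : ℕ} {b : ℕ∞ × ℕ∞} (h : b.1 ≠ ⊤ ∨ b.2 ≠ ⊤) {P : List ℕ} :
    P ∈ boundedParts f b ↔ P.length = f ∧
      (∀ i < f, boundedEntry b.2 P (i + 1) ≤ boundedEntry b.2 P i) ∧ (P.sum : ℕ∞) ≤ b.1 := by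
  induction f generalizing b P with
  | zero => cases P <;> simp [boundedParts]
  | succ f ih =>
    cases P with
    | nil => simp [boundedParts]
    | cons a P =>
      have hsum : ((a + P.sum : ℕ) : ℕ∞) ≤ b.1 ↔ (a : ℕ∞) ≤ b.1 ∧ (P.sum : ℕ∞) ≤ b.1 - a := by
        rw [Nat.cast_add]
        refine ⟨fun h => ⟨le_self_add.trans h, ENat.le_sub_of_add_le_left (by simp) h⟩,
          fun h => (add_le_add_right h.2 _).trans (add_tsub_cancel_of_le h.1).le⟩
      rw [mem_boundedParts_cons h, ih (.inr (ENat.natCast_ne_top a)), Nat.forall_lt_succ_left,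
        List.length_cons, List.sum_cons, hsum]
      simp only [boundedEntry_cons_add_one, boundedEntry_zero, add_left_inj]
      tauto

/-- The contribution to the fermionic sum of a partition with bounds `b`, whose parts `i`
contribute `e i` to the exponent of `q`. -/
noncomputable def partTerm (e : ℕ → ℕ) : ℕ∞ × ℕ∞ → List ℕ → RatFunc ℚ
  | _, [] => 1
  | b, i :: P => q ^ e i * (burgeCoeff b.1 b.2 i * partTerm e (b.1 - i, i) P)

theorem partTerm_eq_prod (e : ℕ → ℕ) (b : ℕ∞ × ℕ∞) (P : List ℕ) :
    partTerm e b P = ∏ i ∈ Finset.range P.length, q ^ e (P.getD i 0) *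
      burgeCoeff (b.1 - (∑ j ∈ Finset.range i, P.getD j 0 : ℕ)) (boundedEntry b.2 P i)
        (P.getD i 0) := by
  induction P generalizing b with
  | nil => simp [partTerm]
  | cons a P ih =>
    rw [partTerm, ih, List.length_cons, Finset.prod_range_succ', ← mul_assoc, mul_comm]
    simp [Finset.sum_range_succ', add_comm _ a, tsub_add_eq_tsub_tsub]

theorem sum_partTerm_mul {e : ℕ → ℕ} {Φ : ℕ → ℕ∞ × ℕ∞ → RatFunc ℚ}
    (hΦ : ∀ f b, b.1 ≠ ⊤ ∨ b.2 ≠ ⊤ →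
      ∑ i ∈ burgeRange b.1 b.2, q ^ e i * (burgeCoeff b.1 b.2 i * Φ f (b.1 - i, i)) = Φ (f + 1) b)
    (f : ℕ) {b : ℕ∞ × ℕ∞} (h : b.1 ≠ ⊤ ∨ b.2 ≠ ⊤) :
    ∑ P ∈ boundedParts f b, partTerm e b P * Φ 0 (afterPart b P) = Φ f b := by
  induction f generalizing b with
  | zero => simp [boundedParts, partTerm]
  | succ f ih =>
    rw [boundedParts, sum_biUnion_image_cons, ← hΦ f b h]
    refine Finset.sum_congr rfl fun i _ => ?_
    rw [← ih (.inr (ENat.natCast_ne_top i)), Finset.mul_sum, Finset.mul_sum]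
    simp only [partTerm, afterPart_cons, mul_assoc]

theorem sum_partTerm_mul_bosSum (n : ℕ) {P' P S R : ℤ} (hP' : 0 < P') (hP : 0 < P) (hS : 0 ≤ S)
    (hS' : S ≤ P') (hR : 0 ≤ R) (hR' : R ≤ P) {b : ℕ∞ × ℕ∞} (h : b.1 ≠ ⊤ ∨ b.2 ≠ ⊤) :
    ∑ Q ∈ boundedParts n b, partTerm (· ^ 2) b Q *
        bosSum P' P S R (afterPart b Q).1 (afterPart b Q).2 =
      bosSum (n * P + P') P (n * R + S) R b.1 b.2 := by
  have step := sum_partTerm_mul (e := (· ^ 2))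
    (Φ := fun n b => bosSum (n * P + P') P (n * R + S) R b.1 b.2) (fun n b hb => ?_) n h
  · simpa using step
  · rw [sum_burgeCoeff_mul_bosSum (by positivity) hP.ne' (by positivity) (by gcongr) hR hR' hb]
    congr 1 <;> push_cast <;> ring

theorem sum_partTerm_mul_tailSum (n : ℕ) {P' P : ℤ} (hP' : 0 < P') (hP : 0 < P)
    {b : ℕ∞ × ℕ∞} (h : b.1 ≠ ⊤ ∨ b.2 ≠ ⊤) :
    ∑ Q ∈ boundedParts n b, partTerm (fun i => i * (i - 1)) b Q *
        tailSum P' P (afterPart b Q).1 (afterPart b Q).2 =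
      tailSum (n * P + P') P b.1 b.2 := by
  have step := sum_partTerm_mul (e := fun i => i * (i - 1))
    (Φ := fun n b => tailSum (n * P + P') P b.1 b.2) (fun n b hb => ?_) n h
  · simpa using step
  · rw [sum_burgeCoeff_mul_tailSum (by positivity) hP hb]
    congr 1; push_cast; ring

/-! ### Sums over sequences of partitions -/

/-- The map sending the pair `(a : b)` to the pair whose continued fraction is that of `(a : b)`
preceded by the entries of `l`. -/
def cfFold (l : List ℕ) (x : ℤ × ℤ) : ℤ × ℤ := l.foldr (fun c y => (c * y.1 + y.2, y.1)) x

@[simp] theorem cfFold_nil (x : ℤ × ℤ) : cfFold [] x = x := rfl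

@[simp] theorem cfFold_cons (a : ℕ) (l : List ℕ) (x : ℤ × ℤ) :
    cfFold (a :: l) x = (a * (cfFold l x).1 + (cfFold l x).2, (cfFold l x).1) := rfl

theorem cfFold_append (l l' : List ℕ) (x : ℤ × ℤ) :
    cfFold (l ++ l') x = cfFold l (cfFold l' x) := by simp [cfFold]

theorem cfFold_pos {l : List ℕ} {x : ℤ × ℤ} (h : 0 < x.1 ∧ 0 < x.2) :
    0 < (cfFold l x).1 ∧ 0 < (cfFold l x).2 := by
  induction l with
  | nil => exact h
  | cons a l ih => exact ⟨add_pos_of_nonneg_of_pos (mul_nonneg a.cast_nonneg ih.1.le) ih.2, ih.1⟩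

theorem cfFold_mono (l : List ℕ) : Monotone (cfFold l) := by
  induction l with
  | nil => exact monotone_id
  | cons a l ih =>
    intro x y h
    obtain ⟨h₁, h₂⟩ := ih h
    simp only [cfFold_cons]
    constructor <;> dsimp only <;> gcongr

theorem cfFold_nonneg {l : List ℕ} {x : ℤ × ℤ} (h : 0 ≤ x) : 0 ≤ cfFold l x := by
  induction l with
  | nil => exact h
  | cons a l ih => exact ⟨add_nonneg (mul_nonneg a.cast_nonneg ih.1) ih.2, ih.1⟩

/-- The bounds for the weight and the parts of the `(k + 1)`-st partition, in terms of the bounds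
`b` left over by the `k`-th one. -/
def nextBounds (u k : ℕ) (b : ℕ∞ × ℕ∞) : ℕ∞ × ℕ∞ :=
  if k < u then (b.2, b.1) else if k = u then (b.1 - 1, b.2 + 1) else (b.2 - 1, b.1 + 1)

theorem nextBounds_ne_top {u k : ℕ} {b : ℕ∞ × ℕ∞} (h : b.1 ≠ ⊤ ∨ b.2 ≠ ⊤) :
    (nextBounds u k b).1 ≠ ⊤ ∨ (nextBounds u k b).2 ≠ ⊤ := by
  unfold nextBounds
  split_ifs
  · exact h.symm
  · simpa [ENat.sub_eq_top_iff] using h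
  · simpa [ENat.sub_eq_top_iff] using h.symm

/-- A sequence of partitions may stop with the `k`-th one if that leaves over the bounds `b`. -/
abbrev CanStop (u t k : ℕ) (b : ℕ∞ × ℕ∞) : Prop := u ≤ k ∧ b.1 = 0 ∧ (k < t + 1 → b.2 = 0)

/-- A sequence of partitions may continue after the `k`-th one if that leaves over the bounds
`b`. -/
abbrev CanContinue (u k : ℕ) (b : ℕ∞ × ℕ∞) : Prop := (k = u → b.1 ≠ 0) ∧ (u < k → b.2 ≠ 0)

/-- The sequences of at most `j` partitions, the first of which has index `k` and bounds `b`, that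
satisfy the conditions of the fermionic sum. -/
noncomputable def boundedSeqs (f : ℕ → ℕ) (u t : ℕ) : ℕ → ℕ → ℕ∞ × ℕ∞ → Finset (List (List ℕ))
  | 0, _, _ => ∅
  | j + 1, k, b => (boundedParts (f k) b).biUnion fun P =>
      ((if CanStop u t k (afterPart b P) then {[]} else ∅) ∪
        if CanContinue u k (afterPart b P) then
          boundedSeqs f u t j (k + 1) (nextBounds u k (afterPart b P)) else ∅).image (List.cons P)

/-- The exponent of `q` contributed by a part `i` of the `k`-th partition. -/
def partExp (u k i : ℕ) : ℕ := if k ≤ u then i ^ 2 else i * (i - 1)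

theorem partExp_of_le {u k : ℕ} (h : k ≤ u) : partExp u k = (· ^ 2) := funext fun _ => if_pos h

theorem partExp_of_lt {u k : ℕ} (h : u < k) : partExp u k = fun i => i * (i - 1) :=
  funext fun _ => if_neg h.not_ge

/-- The summand, up to the factor `(q)_{2N}`, of the fermionic sum attached to a sequence of
partitions, the first of which has index `k` and bounds `b`. -/
noncomputable def seqTerm (u : ℕ) : ℕ → ℕ∞ × ℕ∞ → List (List ℕ) → RatFunc ℚ
  | _, _, [] => 1
  | k, b, P :: l => partTerm (partExp u k) b P *
      ((if k = u then q ^ (afterPart b P).2.toNat else 1) *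
        seqTerm u (k + 1) (nextBounds u k (afterPart b P)) l)

section

variable {f : ℕ → ℕ} {u t : ℕ}

theorem nil_notMem_boundedSeqs (j k : ℕ) (b : ℕ∞ × ℕ∞) : [] ∉ boundedSeqs f u t j k b := by
  cases j <;> simp [boundedSeqs]

theorem sum_boundedSeqs_add_one (j k : ℕ) (b : ℕ∞ × ℕ∞) :
    ∑ l ∈ boundedSeqs f u t (j + 1) k b, seqTerm u k b l =
      ∑ P ∈ boundedParts (f k) b, partTerm (partExp u k) b P *
        ((if k = u then q ^ (afterPart b P).2.toNat else 1) *
        ((if CanStop u t k (afterPart b P) then 1 else 0) +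
          if CanContinue u k (afterPart b P) then
            ∑ l ∈ boundedSeqs f u t j (k + 1) (nextBounds u k (afterPart b P)),
              seqTerm u (k + 1) (nextBounds u k (afterPart b P)) l else 0)) := by
  rw [boundedSeqs, sum_biUnion_image_cons]
  refine Finset.sum_congr rfl fun P _ => ?_
  simp_rw [seqTerm, ← Finset.mul_sum]
  rw [Finset.sum_union]
  · congr 3
    · split_ifs <;> simp [seqTerm]
    · split_ifs <;> simp
  · rw [Finset.disjoint_left]
    intro l hl hl'
    split_ifs at hl hl'
    · exact nil_notMem_boundedSeqs _ _ _ (Finset.mem_singleton.1 hl ▸ hl')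
    all_goals simp at hl hl'

theorem ite_add_tailSum_sub_one {P' P : ℤ} (hP' : P' ≠ 0) (hP : P ≠ 0) {L M : ℕ∞}
    (h : L ≠ ⊤ ∨ M ≠ ⊤) :
    ((if L = 0 ∧ M = 0 then 1 else 0) + if M ≠ 0 then tailSum P P' (M - 1) (L + 1) else 0) =
      tailSum P' P L M := by
  rcases eq_or_ne M 0 with rfl | hM
  · simp [tailSum_zero_right]
  · obtain ⟨M, rfl⟩ := exists_add_of_le (Order.one_le_iff_ne_zero.2 hM)
    rw [add_comm 1 M] at *
    have h' : L ≠ ⊤ ∨ M ≠ ⊤ := h.imp_right fun h h' => h (by simp [h'])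
    simp [(ENat.addLECancellable_of_ne_top ENat.one_ne_top).add_tsub_cancel_right,
      tailSum_swap hP' hP h']

theorem q_pow_mul_ite_add_tailSum_sub_one {P' P : ℤ} (hP' : 0 < P') (hP : 0 < P) (L : ℕ∞) (M : ℕ) :
    q ^ M * ((if L = 0 ∧ M = 0 then 1 else 0) +
      if L ≠ 0 then tailSum P' P (L - 1) (M + 1) else 0) = bosSum P' P 0 1 L M := by
  rcases eq_or_ne L 0 with rfl | hL
  · rw [bosSum_zero_one_zero hP'.ne']
    rcases eq_or_ne M 0 with rfl | hM <;> simp [*]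
  · obtain ⟨L, rfl⟩ := exists_add_of_le (Order.one_le_iff_ne_zero.2 hL)
    rw [add_comm 1 L]
    simp [(ENat.addLECancellable_of_ne_top ENat.one_ne_top).add_tsub_cancel_right,
      bosSum_zero_one hP' hP, tailSum_add_one]

/-- The pair reconstructed from the numbers of parts at the levels after the branching level. -/
def tailPair (f : ℕ → ℕ) (k t : ℕ) : ℤ × ℤ := cfFold ((List.range' k (t + 2 - k)).map f) (1, 2)

theorem tailPair_pos {k : ℕ} : 0 < (tailPair f k t).1 ∧ 0 < (tailPair f k t).2 :=
  cfFold_pos ⟨one_pos, two_pos⟩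

theorem tailPair_of_le {k : ℕ} (hk : k ≤ t + 1) :
    tailPair f k t =
      (f k * (tailPair f (k + 1) t).1 + (tailPair f (k + 1) t).2, (tailPair f (k + 1) t).1) := by
  rw [tailPair, show t + 2 - k = t + 2 - (k + 1) + 1 by omega, List.range'_succ, List.map_cons,
    cfFold_cons, tailPair]

theorem sum_seqTerm_tail {j k : ℕ} (hk : u < k) (hkj : k + j = t + 1) {b : ℕ∞ × ℕ∞}
    (h : b.1 ≠ ⊤ ∨ b.2 ≠ ⊤) :
    ∑ l ∈ boundedSeqs f u t (j + 1) k b, seqTerm u k b l =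
      tailSum (tailPair f k t).1 (tailPair f k t).2 b.1 b.2 := by
  induction j generalizing k b with
  | zero =>
    obtain rfl : k = t + 1 := hkj
    rw [sum_boundedSeqs_add_one, partExp_of_lt hk, tailPair_of_le le_rfl,
      ← sum_partTerm_mul_tailSum _ tailPair_pos.2 tailPair_pos.1 h]
    refine Finset.sum_congr rfl fun P _ => ?_
    rw [show tailPair f (t + 1 + 1) t = (1, 2) by simp [tailPair],
      tailSum_two_one (afterPart_ne_top h P)]
    simp [boundedSeqs, CanStop, hk.le, hk.ne']
  | succ j ih =>
    rw [sum_boundedSeqs_add_one, partExp_of_lt hk, tailPair_of_le (by omega),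
      ← sum_partTerm_mul_tailSum _ tailPair_pos.2 tailPair_pos.1 h]
    refine Finset.sum_congr rfl fun P _ => ?_
    have hP := afterPart_ne_top h P
    rw [ih (by omega) (by omega) (nextBounds_ne_top hP),
      ← ite_add_tailSum_sub_one tailPair_pos.2.ne' tailPair_pos.1.ne' hP]
    simp [nextBounds, CanStop, CanContinue, hk, hk.le, hk.ne', hk.not_gt, show k < t + 1 by omega]

/-- The pair reconstructed from the numbers of parts at the branching level `u` and after it. -/
def branchPair (f : ℕ → ℕ) (u t : ℕ) : ℤ × ℤ :=
  (f u * (tailPair f (u + 1) t).2 + (tailPair f (u + 1) t).1, (tailPair f (u + 1) t).2)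

theorem branchPair_pos : 0 < (branchPair f u t).1 ∧ 0 < (branchPair f u t).2 :=
  ⟨add_pos_of_nonneg_of_pos (mul_nonneg (Nat.cast_nonneg _) tailPair_pos.2.le) tailPair_pos.1,
    tailPair_pos.2⟩

theorem le_branchPair : ((f u : ℤ), (1 : ℤ)) ≤ branchPair f u t := by
  obtain ⟨h₁, h₂⟩ := tailPair_pos (f := f) (t := t) (k := u + 1)
  exact ⟨le_add_of_le_of_nonneg (le_mul_of_one_le_right (Nat.cast_nonneg _) h₂) h₁.le, h₂⟩

theorem sum_seqTerm_branch (hut : u ≤ t) (hfu : f u ≠ 0) {b : ℕ∞ × ℕ∞} (h : b.1 ≠ ⊤ ∨ b.2 ≠ ⊤) :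
    ∑ l ∈ boundedSeqs f u t (t + 1 - u + 1) u b, seqTerm u u b l =
      bosSum (branchPair f u t).1 (branchPair f u t).2 (f u) 1 b.1 b.2 := by
  obtain ⟨hpos₁, hpos₂⟩ := tailPair_pos (f := f) (t := t) (k := u + 1)
  have hsum := sum_partTerm_mul_bosSum (f u) hpos₁ hpos₂ le_rfl hpos₁.le zero_le_one hpos₂ h
  rw [mul_one, add_zero] at hsum
  rw [sum_boundedSeqs_add_one, partExp_of_le le_rfl, branchPair, ← hsum]
  refine Finset.sum_congr rfl fun P hP => ?_
  have hPnil : P ≠ [] := by rintro rfl; exact hfu ((mem_boundedParts h).1 hP).1.symm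
  obtain ⟨M, hM⟩ := ENat.ne_top_iff_exists.1 (lastEntry_ne_top (top := b.2) (.inr hPnil))
  have hM' : (afterPart b P).2 = M := hM.symm
  rw [show t + 1 - u = t - u + 1 by omega,
    sum_seqTerm_tail u.lt_succ_self (by omega) (nextBounds_ne_top (afterPart_ne_top h P))]
  simp [nextBounds, CanStop, CanContinue, hM', show u < t + 1 by omega,
    ← q_pow_mul_ite_add_tailSum_sub_one hpos₁ hpos₂]

theorem sum_seqTerm_head (hut : u ≤ t) (hfu : f u ≠ 0) {i k : ℕ} (hk : k + i = u) {b : ℕ∞ × ℕ∞}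
    (h : b.1 ≠ ⊤ ∨ b.2 ≠ ⊤) :
    ∑ l ∈ boundedSeqs f u t (t + 1 - k + 1) k b, seqTerm u k b l =
      bosSum (cfFold ((List.range' k i).map f) (branchPair f u t)).1
        (cfFold ((List.range' k i).map f) (branchPair f u t)).2
        (cfFold ((List.range' k i).map f) (f u, 1)).1
        (cfFold ((List.range' k i).map f) (f u, 1)).2 b.1 b.2 := by
  induction i generalizing k b with
  | zero =>
    obtain rfl : k = u := hk
    exact sum_seqTerm_branch hut hfu h
  | succ i ih =>
    obtain ⟨hpos₁, hpos₂⟩ := cfFold_pos (l := (List.range' (k + 1) i).map f)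
      (branchPair_pos (f := f) (u := u) (t := t))
    have hle := cfFold_mono ((List.range' (k + 1) i).map f)
      (le_branchPair (f := f) (u := u) (t := t))
    have hnonneg := cfFold_nonneg (l := (List.range' (k + 1) i).map f) (x := ((f u : ℤ), (1 : ℤ)))
      ⟨Nat.cast_nonneg _, zero_le_one⟩
    rw [sum_boundedSeqs_add_one, partExp_of_le (by omega), List.range'_succ, List.map_cons,
      cfFold_cons, cfFold_cons,
      ← sum_partTerm_mul_bosSum (f k) hpos₂ hpos₁ hnonneg.2 hle.2 hnonneg.1 hle.1 h]
    refine Finset.sum_congr rfl fun P _ => ?_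
    have hP := afterPart_ne_top h P
    rw [show t + 1 - k = t + 1 - (k + 1) + 1 by omega, ih (by omega) (nextBounds_ne_top hP),
      bosSum_swap hpos₂.ne' hpos₁.ne' hP]
    simp [nextBounds, CanStop, CanContinue, show k < u by omega, show k ≠ u by omega,
      show ¬ u < k by omega]

end

/-! ### Admissible sequences -/

section

variable {f : ℕ → ℕ} {u t j k : ℕ} {b : ℕ∞ × ℕ∞} {P : List ℕ} {l : List (List ℕ)}

theorem cons_mem_boundedSeqs_iff :
    P :: l ∈ boundedSeqs f u t (j + 1) k b ↔ P ∈ boundedParts (f k) b ∧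
      (CanStop u t k (afterPart b P) ∧ l = [] ∨ CanContinue u k (afterPart b P) ∧
        l ∈ boundedSeqs f u t j (k + 1) (nextBounds u k (afterPart b P))) := by
  have hite (p : Prop) [Decidable p] (s : Finset (List (List ℕ))) :
      (l ∈ if p then s else ∅) ↔ p ∧ l ∈ s := by split_ifs with hp <;> simp [hp]
  simp [boundedSeqs, hite, List.cons.injEq]

theorem singleton_mem_boundedSeqs_iff :
    [P] ∈ boundedSeqs f u t (j + 1) k b ↔
      P ∈ boundedParts (f k) b ∧ CanStop u t k (afterPart b P) := by
  simp [cons_mem_boundedSeqs_iff, nil_notMem_boundedSeqs]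

theorem cons_mem_boundedSeqs_iff_of_ne_nil (hl : l ≠ []) :
    P :: l ∈ boundedSeqs f u t (j + 1) k b ↔
      P ∈ boundedParts (f k) b ∧ CanContinue u k (afterPart b P) ∧
        l ∈ boundedSeqs f u t j (k + 1) (nextBounds u k (afterPart b P)) := by
  simp [cons_mem_boundedSeqs_iff, hl]

end

section

variable {f : ℕ → ℕ} {u t N : ℕ} {n : List (List ℕ)} {k : ℕ}

/-- The bounds left over by the `k`-th partition of the sequence `n`. -/
def leftover (f : ℕ → ℕ) (u N : ℕ) (n : List (List ℕ)) (k : ℕ) : ℕ∞ × ℕ∞ :=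
  afterPart (bounds f u N n k) (part n k)

/-- The conditions on the `k`-th partition of an admissible sequence. -/
structure AdmissibleAt (f : ℕ → ℕ) (t u N : ℕ) (n : List (List ℕ)) (k : ℕ) : Prop where
  part_mem : part n k ∈ boundedParts (f k) (bounds f u N n k)
  canStop : k = n.length → CanStop u t k (leftover f u N n k)
  canContinue : k < n.length → CanContinue u k (leftover f u N n k)

theorem bounds_ne_top (k : ℕ) : (bounds f u N n k).1 ≠ ⊤ ∨ (bounds f u N n k).2 ≠ ⊤ := by
  induction k with
  | zero => simp [bounds]
  | succ k ih =>
    cases k with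
    | zero => simp [bounds]
    | succ k =>
      simp only [bounds]
      split_ifs <;> simp_all [ENat.sub_eq_top_iff, or_comm]

theorem part_mem_boundedParts_iff :
    part n k ∈ boundedParts (f k) (bounds f u N n k) ↔ (part n k).length = f k ∧
      (∀ i, 1 ≤ i → i ≤ f k → entry f u N n k i ≤ entry f u N n k (i - 1)) ∧
      (wt n k : ℕ∞) ≤ wBound f u N n k := by
  rw [mem_boundedParts (bounds_ne_top k)]
  refine and_congr_right fun _ => and_congr_left fun _ => ⟨fun h i hi hik => ?_, fun h i hi => ?_⟩
  · obtain ⟨i, rfl⟩ := Nat.exists_eq_add_of_le' hi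
    exact h i hik
  · exact h (i + 1) (by omega) hi

theorem length_part_of_mem (h : part n k ∈ boundedParts (f k) (bounds f u N n k)) :
    (part n k).length = f k := (part_mem_boundedParts_iff.1 h).1

theorem wt_le_of_mem (h : part n k ∈ boundedParts (f k) (bounds f u N n k)) :
    (wt n k : ℕ∞) ≤ wBound f u N n k := (part_mem_boundedParts_iff.1 h).2.2

theorem leftover_snd (h : part n k ∈ boundedParts (f k) (bounds f u N n k)) :
    (leftover f u N n k).2 = entry f u N n k (f k) := by
  rw [← length_part_of_mem h]; rfl

theorem leftover_fst_eq_zero (h : part n k ∈ boundedParts (f k) (bounds f u N n k)) :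
    (leftover f u N n k).1 = 0 ↔ (wt n k : ℕ∞) = wBound f u N n k :=
  tsub_eq_zero_iff_le.trans (wt_le_of_mem h).ge_iff_eq

theorem leftover_fst_ne_zero (h : part n k ∈ boundedParts (f k) (bounds f u N n k)) :
    (leftover f u N n k).1 ≠ 0 ↔ (wt n k : ℕ∞) < wBound f u N n k := by
  rw [Ne, leftover_fst_eq_zero h, (wt_le_of_mem h).lt_iff_ne]

theorem bounds_add_one (hk : k ≠ 0) (h : part n k ∈ boundedParts (f k) (bounds f u N n k)) :
    bounds f u N n (k + 1) = nextBounds u k (leftover f u N n k) := by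
  obtain ⟨k, rfl⟩ := Nat.exists_eq_add_one_of_ne_zero hk
  have hadd : wBound f u N n (k + 1) + 1 - wt n (k + 1) = (leftover f u N n (k + 1)).1 + 1 :=
    ((ENat.addLECancellable_natCast _).tsub_add_eq_add_tsub (wt_le_of_mem h)).symm
  have hsub : wBound f u N n (k + 1) - 1 - wt n (k + 1) = (leftover f u N n (k + 1)).1 - 1 :=
    tsub_right_comm
  rw [nextBounds, ← hadd, ← hsub, leftover_snd h]
  simp only [Nat.lt_iff_add_one_le, ← Nat.add_right_cancel_iff (n := 1) (m := k + 1)]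
  rfl

theorem admissible_iff {c : ℕ → ℕ} {d : ℕ} (hu : 1 ≤ u) :
    Admissible c t u d N n ↔ 1 ≤ n.length ∧ n.length ≤ t + 1 ∧
      ∀ k, 1 ≤ k → k ≤ n.length → AdmissibleAt (fSeq c u d) t u N n k := by
  constructor
  · intro h
    have hmem k (hk : 1 ≤ k) (hkn : k ≤ n.length) :=
      part_mem_boundedParts_iff.2 ⟨h.length_part k hk hkn, h.antitone k hk hkn, h.wt_le k hk hkn⟩
    refine ⟨hu.trans h.le_length, h.length_le, fun k hk hkn => ⟨hmem k hk hkn, ?_, fun hlt => ?_⟩⟩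
    · rintro rfl
      exact ⟨h.le_length, (leftover_fst_eq_zero (hmem _ hk hkn)).2 h.wt_length,
        fun hlt => (leftover_snd (hmem _ hk hkn)).trans (h.last_eq_zero hlt)⟩
    · refine ⟨?_, fun huk => ?_⟩
      · rintro rfl
        exact (leftover_fst_ne_zero (hmem _ hk hkn)).2 (h.wt_lt hlt)
      · rw [leftover_snd (hmem _ hk hkn)]
        exact (h.last_pos k huk hlt).ne'
  · rintro ⟨hn, hnt, h⟩
    have hmem k (hk : 1 ≤ k) (hkn : k ≤ n.length) := (h k hk hkn).part_mem
    obtain ⟨hun, hw, hlast⟩ := (h _ hn le_rfl).canStop rfl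
    refine ⟨hun, hnt, fun k hk hkn => length_part_of_mem (hmem k hk hkn),
      fun k hk hkn => (part_mem_boundedParts_iff.1 (hmem k hk hkn)).2.1,
      fun k hk hkn => wt_le_of_mem (hmem k hk hkn), (leftover_fst_eq_zero (hmem _ hn le_rfl)).1 hw,
      fun hlt => (leftover_fst_ne_zero (hmem u hu hun)).1 (((h u hu hun).canContinue hlt).1 rfl),
      fun k huk hkn => ?_, fun hlt => leftover_snd (hmem _ hn le_rfl) ▸ hlast hlt⟩
    have hk : 1 ≤ k := hu.trans huk.le
    rw [pos_iff_ne_zero, ← leftover_snd (hmem k hk hkn.le)]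
    exact ((h k hk hkn.le).canContinue hkn).2 huk

theorem drop_sub_one_eq_cons (hk : 1 ≤ k) (hkn : k ≤ n.length) :
    n.drop (k - 1) = part n k :: n.drop k := by
  obtain ⟨k, rfl⟩ := Nat.exists_eq_add_of_le' hk
  rw [Nat.add_sub_cancel, List.drop_eq_getElem_cons hkn, part, Nat.add_sub_cancel,
    List.getD_eq_getElem]

theorem drop_mem_boundedSeqs_iff {j : ℕ} (hk : 1 ≤ k) (hkj : k + j = t + 2) :
    n.drop (k - 1) ∈ boundedSeqs f u t j k (bounds f u N n k) ↔
      k ≤ n.length ∧ n.length ≤ t + 1 ∧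
        ∀ i, k ≤ i → i ≤ n.length → AdmissibleAt f t u N n i := by
  induction j generalizing k with
  | zero =>
    simp only [boundedSeqs, Finset.notMem_empty, false_iff]
    omega
  | succ j ih =>
    rcases lt_trichotomy n.length k with hkn | rfl | hkn
    · rw [List.drop_eq_nil_of_le (by omega)]
      exact iff_of_false (nil_notMem_boundedSeqs _ _ _) (by omega)
    · rw [drop_sub_one_eq_cons hk le_rfl, List.drop_length, singleton_mem_boundedSeqs_iff]
      refine ⟨fun ⟨hmem, hcanStop⟩ => ⟨le_rfl, by omega, fun i hi hi' => ?_⟩,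
        fun ⟨_, _, h⟩ => ⟨(h _ le_rfl le_rfl).part_mem, (h _ le_rfl le_rfl).canStop rfl⟩⟩
      obtain rfl := hi.antisymm hi'
      exact ⟨hmem, fun _ => hcanStop, fun h => absurd h (lt_irrefl _)⟩
    · have ih' := ih (k := k + 1) (by omega) (by omega)
      rw [Nat.add_sub_cancel] at ih'
      rw [drop_sub_one_eq_cons hk hkn.le,
        cons_mem_boundedSeqs_iff_of_ne_nil (by simpa using hkn), ← leftover]
      constructor
      · rintro ⟨hmem, hcont, hl⟩
        rw [← bounds_add_one (by omega) hmem, ih'] at hl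
        refine ⟨hkn.le, hl.2.1, fun i hi hi' => ?_⟩
        rcases hi.eq_or_lt with rfl | hi
        · exact ⟨hmem, fun h => absurd h hkn.ne, fun _ => hcont⟩
        · exact hl.2.2 i hi hi'
      · rintro ⟨-, hnt, h⟩
        have hk' := h k le_rfl hkn.le
        rw [← bounds_add_one (by omega) hk'.part_mem, ih']
        exact ⟨hk'.part_mem, hk'.canContinue hkn, hkn, hnt, fun i hi => h i (by omega)⟩

theorem mem_boundedSeqs_iff {c : ℕ → ℕ} {d : ℕ} (hu : 1 ≤ u) :
    n ∈ boundedSeqs (fSeq c u d) u t (t + 1) 1 (⊤, N) ↔ Admissible c t u d N n := by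
  rw [admissible_iff hu]
  exact drop_mem_boundedSeqs_iff le_rfl (by omega)

end

/-! ### The summands as products -/

@[to_additive sum_range_add_one_eq_sum_Icc]
theorem prod_range_add_one_eq_prod_Icc {M : Type*} [CommMonoid M] (m : ℕ) (g : ℕ → M) :
    ∏ i ∈ Finset.range m, g (i + 1) = ∏ i ∈ Finset.Icc 1 m, g i := by
  rw [Finset.range_eq_Ico, Finset.prod_Ico_add' g, zero_add, Finset.Ico_add_one_right_eq_Icc]

section

variable {f : ℕ → ℕ} {u t N : ℕ} {n : List (List ℕ)} {k : ℕ}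

theorem entryNat_add_one (i : ℕ) : entryNat f u N n k (i + 1) = (part n k).getD i 0 := rfl

theorem coe_entryNat {i : ℕ} (h : (bounds f u N n k).2 ≠ ⊤ ∨ i ≠ 0) :
    (entryNat f u N n k i : ℕ∞) = entry f u N n k i := by
  rcases i with _ | i
  · exact ENat.natCast_toNat (h.resolve_right (absurd rfl))
  · rfl

theorem wt_eq_sum_entryNat (h : (part n k).length = f k) :
    wt n k = ∑ i ∈ Finset.Icc 1 (f k), entryNat f u N n k i := by
  simp only [← sum_range_add_one_eq_sum_Icc, entryNat_add_one, ← h, wt]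
  rw [Finset.sum_range, ← Fin.sum_univ_getElem]
  simp

/-- The coefficient contributed by the entry `n_{k,i}` to the Burge transforms. -/
noncomputable def burgeAt (f : ℕ → ℕ) (u N : ℕ) (n : List (List ℕ)) (k i : ℕ) : RatFunc ℚ :=
  burgeCoeff (wBound f u N n k - (∑ j ∈ Finset.Icc 1 (i - 1), entryNat f u N n k j : ℕ))
    (entry f u N n k (i - 1)) (entryNat f u N n k i)

theorem partTerm_eq_mul_prod_burgeAt (e : ℕ → ℕ) (h : (part n k).length = f k) :
    partTerm e (bounds f u N n k) (part n k) =
      q ^ (∑ i ∈ Finset.Icc 1 (f k), e (entryNat f u N n k i)) *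
        ∏ i ∈ Finset.Icc 1 (f k), burgeAt f u N n k i := by
  rw [partTerm_eq_prod, h, ← Finset.prod_pow_eq_pow_sum, ← Finset.prod_mul_distrib,
    ← prod_range_add_one_eq_prod_Icc]
  simp only [burgeAt, ← sum_range_add_one_eq_sum_Icc]
  rfl

theorem seqTerm_drop (hk : 1 ≤ k)
    (h : ∀ i, k ≤ i → i ≤ n.length → part n i ∈ boundedParts (f i) (bounds f u N n i)) :
    seqTerm u k (bounds f u N n k) (n.drop (k - 1)) =
      ∏ i ∈ Finset.Icc k n.length, partTerm (partExp u i) (bounds f u N n i) (part n i) *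
        (if i = u then q ^ (leftover f u N n i).2.toNat else 1) := by
  induction hm : n.length + 1 - k generalizing k with
  | zero =>
    rw [List.drop_eq_nil_of_le (by omega), Finset.Icc_eq_empty (by omega), Finset.prod_empty,
      seqTerm]
  | succ m ih =>
    rw [drop_sub_one_eq_cons hk (by omega), seqTerm, ← leftover,
      ← bounds_add_one (by omega) (h k le_rfl (by omega)),
      ← Finset.mul_prod_Ioc_eq_prod_Icc (by omega : k ≤ n.length),
      ← Finset.Icc_add_one_left_eq_Ioc, ← ih (by omega) (fun i hi => h i (by omega)) (by omega),
      Nat.add_sub_cancel, mul_assoc]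

theorem fermExponent_eq {d : ℕ} (hun : u ≤ n.length) :
    fermExponent f u d N n = (∑ k ∈ Finset.Icc 1 n.length, ∑ i ∈ Finset.Icc 1 (f k),
      partExp u k (entryNat f u N n k i)) + entryNat f u N n u d := by
  simp_rw [← Finset.Ico_add_one_right_eq_Icc 1 n.length]
  rw [← Finset.sum_Ico_consecutive _ (by omega : 1 ≤ u + 1) (by omega), fermExponent, add_assoc,
    add_comm, Finset.Ico_add_one_right_eq_Icc, Finset.Ico_add_one_right_eq_Icc]
  congr 2 <;> refine Finset.sum_congr rfl fun k hk => ?_ <;> rw [Finset.mem_Icc] at hk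
  · rw [partExp_of_le hk.2]
  · rw [partExp_of_lt hk.1]

theorem seqTerm_eq_mul_prod (hu : 1 ≤ u) (hun : u ≤ n.length)
    (h : ∀ k, 1 ≤ k → k ≤ n.length → part n k ∈ boundedParts (f k) (bounds f u N n k)) :
    seqTerm u 1 (⊤, N) n = q ^ fermExponent f u (f u) N n *
      ∏ k ∈ Finset.Icc 1 n.length, ∏ i ∈ Finset.Icc 1 (f k), burgeAt f u N n k i := by
  have hbranch : ∏ k ∈ Finset.Icc 1 n.length,
      (if k = u then q ^ (leftover f u N n k).2.toNat else 1) =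
        q ^ entryNat f u N n u (f u) := by
    rw [Finset.prod_ite_eq', if_pos (Finset.mem_Icc.2 ⟨hu, hun⟩), leftover_snd (h u hu hun),
      entryNat]
  have hparts : ∀ k ∈ Finset.Icc 1 n.length,
      partTerm (partExp u k) (bounds f u N n k) (part n k) =
        q ^ (∑ i ∈ Finset.Icc 1 (f k), partExp u k (entryNat f u N n k i)) *
          ∏ i ∈ Finset.Icc 1 (f k), burgeAt f u N n k i := fun k hk =>
    partTerm_eq_mul_prod_burgeAt _
      (length_part_of_mem (h k (Finset.mem_Icc.1 hk).1 (Finset.mem_Icc.1 hk).2))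
  refine (seqTerm_drop le_rfl h).trans ?_
  rw [Finset.prod_mul_distrib, hbranch, Finset.prod_congr rfl hparts, Finset.prod_mul_distrib,
    Finset.prod_pow_eq_pow_sum, mul_right_comm, ← pow_add, fermExponent_eq hun]

theorem prod_burgeAt_eq_invFactor (h : part n k ∈ boundedParts (f k) (bounds f u N n k))
    (hw : wBound f u N n k = ⊤) (htop : (bounds f u N n k).2 ≠ ⊤) :
    ∏ i ∈ Finset.Icc 1 (f k), burgeAt f u N n k i = invFactor f u N n k := by
  refine Finset.prod_congr rfl fun i hi => ?_
  obtain ⟨hi, hif⟩ := Finset.mem_Icc.1 hi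
  have hle := (part_mem_boundedParts_iff.1 h).2.1 i hi hif
  rw [← coe_entryNat (.inl htop), ← coe_entryNat (.inl htop), ENat.natCast_le_natCast] at hle
  rw [burgeAt, hw, ENat.top_sub_natCast, ← coe_entryNat (.inl htop), burgeCoeff_top_left,
    ← Nat.cast_sub hle, invPoch_natCast, one_div]

/-- The Gaussian `G_{k,i}`. -/
noncomputable def gaussAt (f : ℕ → ℕ) (u N : ℕ) (n : List (List ℕ)) (k i : ℕ) : RatFunc ℚ :=
  gauss
    (2 * (((wBound f u N n k).toNat : ℤ) - ∑ j ∈ Finset.Icc 1 i, (entryNat f u N n k j : ℤ))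
      + entryNat f u N n k (i - 1) + entryNat f u N n k i)
    ((entryNat f u N n k (i - 1) : ℤ) - entryNat f u N n k i)

theorem burgeAt_eq_gaussAt {i : ℕ} (h : part n k ∈ boundedParts (f k) (bounds f u N n k))
    (hw : wBound f u N n k ≠ ⊤) (hi : 1 ≤ i) (hif : i ≤ f k)
    (htop : (bounds f u N n k).2 ≠ ⊤ ∨ i - 1 ≠ 0) :
    burgeAt f u N n k i = gaussAt f u N n k i := by
  obtain ⟨W, hW⟩ := ENat.ne_top_iff_exists.1 hw
  obtain ⟨i, rfl⟩ := Nat.exists_eq_add_of_le' hi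
  have hsum : ∑ j ∈ Finset.Icc 1 i, entryNat f u N n k j ≤ W := by
    have hwt := wt_le_of_mem h
    rw [← hW, ENat.natCast_le_natCast, wt_eq_sum_entryNat (length_part_of_mem h)] at hwt
    exact (Finset.sum_le_sum_of_subset (Finset.Icc_subset_Icc_right (by omega))).trans hwt
  rw [burgeAt, ← coe_entryNat htop, gaussAt, ← hW, Nat.add_sub_cancel, ← ENat.natCast_sub,
    burgeCoeff_natCast, ENat.toNat_natCast, Nat.cast_sub hsum,
    Finset.sum_Icc_succ_top (by omega)]
  congr 1
  push_cast
  ring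

theorem prod_burgeAt_eq_prod_gaussAt (h : part n k ∈ boundedParts (f k) (bounds f u N n k))
    (hw : wBound f u N n k ≠ ⊤) (htop : (bounds f u N n k).2 ≠ ⊤) :
    ∏ i ∈ Finset.Icc 1 (f k), burgeAt f u N n k i =
      ∏ i ∈ Finset.Icc 1 (f k), gaussAt f u N n k i :=
  Finset.prod_congr rfl fun _ hi =>
    burgeAt_eq_gaussAt h hw (Finset.mem_Icc.1 hi).1 (Finset.mem_Icc.1 hi).2 (.inl htop)

theorem prod_burgeAt_eq_mul_prod_gaussAt
    (h : part n k ∈ boundedParts (f k) (bounds f u N n k))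
    (hw : wBound f u N n k ≠ ⊤) (htop : (bounds f u N n k).2 = ⊤)
    (hf : f k = 0 → wBound f u N n k = 0) :
    ∏ i ∈ Finset.Icc 1 (f k), burgeAt f u N n k i =
      1 / qPoch (2 * (wBound f u N n k).toNat) *
        ∏ i ∈ Finset.Icc 2 (f k), gaussAt f u N n k i := by
  rcases (f k).eq_zero_or_pos with hm | hm
  · simp [hm, hf hm, qPoch_zero]
  · have hfirst : burgeAt f u N n k 1 = 1 / qPoch (2 * (wBound f u N n k).toNat) := by
      obtain ⟨W, hW⟩ := ENat.ne_top_iff_exists.1 hw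
      have hentry : entry f u N n k 0 = ⊤ := htop
      simp only [burgeAt, ← hW, hentry, Nat.sub_self, Finset.Icc_eq_empty_of_lt one_pos,
        Finset.sum_empty, Nat.cast_zero, tsub_zero, burgeCoeff_top_right, ENat.toNat_natCast]
      rw [one_div, ← invPoch_natCast]
      push_cast
      rfl
    rw [← Finset.mul_prod_Ioc_eq_prod_Icc hm, hfirst, ← Finset.Icc_add_one_left_eq_Ioc]
    congr 1
    refine Finset.prod_congr rfl fun i hi => ?_
    obtain ⟨hi, hif⟩ := Finset.mem_Icc.1 hi
    exact burgeAt_eq_gaussAt h hw (by omega) hif (.inr (by omega))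

theorem nextBounds_ne_top_and_ne_top {b : ℕ∞ × ℕ∞} (h₁ : b.1 ≠ ⊤) (h₂ : b.2 ≠ ⊤) :
    (nextBounds u k b).1 ≠ ⊤ ∧ (nextBounds u k b).2 ≠ ⊤ := by
  unfold nextBounds
  split_ifs <;> simp [h₁, h₂, ENat.sub_eq_top_iff]

theorem bounds_ne_top_of_lt {m : ℕ} (hm : m ≠ 0) (hw : wBound f u N n m ≠ ⊤)
    (hlast : (leftover f u N n m).2 ≠ ⊤) (hmk : m < k)
    (h : ∀ i, m ≤ i → i < k → part n i ∈ boundedParts (f i) (bounds f u N n i)) :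
    (bounds f u N n k).1 ≠ ⊤ ∧ (bounds f u N n k).2 ≠ ⊤ := by
  induction k, hmk using Nat.le_induction with
  | base =>
    rw [bounds_add_one hm (h m le_rfl m.lt_succ_self)]
    exact nextBounds_ne_top_and_ne_top (ne_top_of_le_ne_top hw tsub_le_self) hlast
  | succ k hmk ih =>
    obtain ⟨hw, htop⟩ := ih fun i hi hik => h i hi (by omega)
    rw [bounds_add_one (by omega) (h k (by omega) k.lt_succ_self)]
    exact nextBounds_ne_top_and_ne_top (ne_top_of_le_ne_top hw tsub_le_self)
      (lastEntry_ne_top (.inl htop))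

theorem prod_burgeAt_Icc_eq_gaussFactor {m : ℕ} (hm : 1 ≤ m) (hmn : m ≤ n.length)
    (h : ∀ k, m ≤ k → k ≤ n.length → AdmissibleAt f t u N n k)
    (hw : wBound f u N n m ≠ ⊤) (htop : (bounds f u N n m).2 = ⊤)
    (hf : m < n.length → f m ≠ 0) :
    ∏ k ∈ Finset.Icc m n.length, ∏ i ∈ Finset.Icc 1 (f k), burgeAt f u N n k i =
      1 / qPoch (2 * (wBound f u N n m).toNat) * gaussFactor f u N n m := by
  have hmem := (h m le_rfl hmn).part_mem
  have hzero (h0 : f m = 0) : wBound f u N n m = 0 := by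
    have hmn' : m = n.length := by
      by_contra hne
      exact hf (by omega) h0
    rw [← (leftover_fst_eq_zero hmem).1 ((h m le_rfl hmn'.le).canStop hmn').2.1,
      wt_eq_sum_entryNat (u := u) (N := N) (length_part_of_mem hmem), h0]
    rfl
  have hgauss : gaussFactor f u N n m = ∏ k ∈ Finset.Icc m n.length,
    ∏ i ∈ Finset.Icc (1 + if k = m then 1 else 0) (f k), gaussAt f u N n k i := rfl
  rw [hgauss, ← Finset.mul_prod_Ioc_eq_prod_Icc hmn, ← Finset.mul_prod_Ioc_eq_prod_Icc hmn,
    prod_burgeAt_eq_mul_prod_gaussAt hmem hw htop hzero, if_pos rfl, mul_assoc]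
  congr 2
  refine Finset.prod_congr rfl fun k hk => ?_
  obtain ⟨hmk, hkn⟩ := Finset.mem_Ioc.1 hk
  have hlast : (leftover f u N n m).2 ≠ ⊤ := lastEntry_ne_top <| .inr fun hnil =>
    hf (by omega) (by rw [← length_part_of_mem hmem, hnil, List.length_nil])
  obtain ⟨hw, htop⟩ := bounds_ne_top_of_lt (by omega) hw hlast hmk
    fun i hi hik => (h i hi (by omega)).part_mem
  rw [prod_burgeAt_eq_prod_gaussAt (h k hmk.le hkn).part_mem hw htop, if_neg hmk.ne', add_zero]

theorem seqTerm_eq_fermTerm (hu : 1 < u) (hun : u ≤ n.length)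
    (h : ∀ k, 1 ≤ k → k ≤ n.length → AdmissibleAt f t u N n k)
    (hf : 2 < n.length → f 2 ≠ 0) :
    seqTerm u 1 (⊤, N) n = fermTerm f u (f u) N n := by
  have hmem := (h 1 le_rfl (by omega)).part_mem
  have htop : (bounds f u N n 1).2 ≠ ⊤ := ENat.natCast_ne_top N
  have hb : bounds f u N n 2 = (entry f u N n 1 (f 1), ⊤) := by
    rw [bounds_add_one one_ne_zero hmem, nextBounds, if_pos hu, leftover_snd hmem]
    rfl
  have hw : wBound f u N n 2 = entryNat f u N n 1 (f 1) := by
    rw [coe_entryNat (.inl htop), wBound, hb]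
  rw [seqTerm_eq_mul_prod hu.le hun fun k hk hkn => (h k hk hkn).part_mem,
    ← Finset.mul_prod_Ioc_eq_prod_Icc (by omega), ← Finset.Icc_add_one_left_eq_Ioc,
    one_add_one_eq_two, prod_burgeAt_eq_invFactor hmem rfl htop,
    prod_burgeAt_Icc_eq_gaussFactor (by omega) (by omega) (fun k hk => h k (by omega))
      (hw ▸ ENat.natCast_ne_top _) (by rw [hb]) hf, hw, ENat.toNat_natCast, fermTerm]
  ring

theorem seqTerm_eq_fermTermOne (hn : 1 ≤ n.length)
    (h : ∀ k, 1 ≤ k → k ≤ n.length → AdmissibleAt f t 1 N n k)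
    (hf : 3 < n.length → f 3 ≠ 0) :
    seqTerm 1 1 (⊤, N) n = fermTermOne f (f 1) N n := by
  have hlt {k} (hk : 1 ≤ k) (hkn : k ≤ n.length) (hw : wBound f 1 N n k = ⊤) : k < n.length := by
    refine hkn.lt_of_ne fun hk' => ENat.natCast_ne_top (wt n k) ?_
    rw [(leftover_fst_eq_zero (h k hk hkn).part_mem).1 ((h k hk hkn).canStop hk').2.1, hw]
  have hmem₁ := (h 1 le_rfl hn).part_mem
  have htop₁ : (bounds f 1 N n 1).2 ≠ ⊤ := ENat.natCast_ne_top N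
  have hn₁ := hlt le_rfl hn rfl
  have hmem₂ := (h 2 one_le_two hn₁).part_mem
  have hb₂ : bounds f 1 N n 2 = (⊤, (entryNat f 1 N n 1 (f 1) : ℕ∞) + 1) := by
    rw [bounds_add_one one_ne_zero hmem₁, nextBounds, if_neg (lt_irrefl 1), if_pos rfl,
      leftover_snd hmem₁, coe_entryNat (.inl htop₁)]
    rfl
  have htop₂ : (bounds f 1 N n 2).2 ≠ ⊤ := by simp [hb₂]
  have hn₂ := hlt one_le_two hn₁ (by rw [wBound, hb₂])
  have hb₃ : bounds f 1 N n 3 = (((entryNat f 1 N n 2 (f 2) - 1 : ℕ) : ℕ∞), ⊤) := by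
    rw [bounds_add_one two_ne_zero hmem₂, nextBounds, if_neg (by omega), if_neg (by omega),
      leftover_snd hmem₂, leftover, afterPart, hb₂, ← coe_entryNat (.inl htop₂)]
    rfl
  rw [seqTerm_eq_mul_prod le_rfl hn fun k hk hkn => (h k hk hkn).part_mem,
    ← Finset.mul_prod_Ioc_eq_prod_Icc hn, ← Finset.Icc_add_one_left_eq_Ioc,
    one_add_one_eq_two, ← Finset.mul_prod_Ioc_eq_prod_Icc (a := 2) hn₁,
    ← Finset.Icc_add_one_left_eq_Ioc, two_add_one_eq_three,
    prod_burgeAt_eq_invFactor hmem₁ rfl htop₁,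
    prod_burgeAt_eq_invFactor hmem₂ (by rw [wBound, hb₂]) htop₂,
    prod_burgeAt_Icc_eq_gaussFactor (m := 3) (by omega) hn₂ (fun k hk => h k (by omega))
      (by simp [wBound, hb₃]) (by rw [hb₃]) hf, wBound, hb₃, ENat.toNat_natCast, fermTermOne]
  ring

end

/-! ### Continued fractions -/

theorem cfFold_contFrac {s r : ℕ} (h : Nat.Coprime s r) :
    cfFold (contFrac s r) (1, 0) = ((s : ℤ), (r : ℤ)) := by
  induction r using Nat.strong_induction_on generalizing s with
  | _ r ih =>
    rw [contFrac]
    split_ifs with hr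
    · simp [hr, (Nat.coprime_zero_right s).1 (hr ▸ h)]
    · have hmod : Nat.Coprime r (s % r) := by
        rwa [Nat.Coprime, Nat.gcd_comm, ← Nat.gcd_rec, Nat.gcd_comm]
      have hdiv : (s : ℤ) / r * r + s % r = s := Int.ediv_mul_add_emod s r
      rw [cfFold_cons, ih (s % r) (Nat.mod_lt _ (Nat.pos_of_ne_zero hr)) hmod]
      simp [hdiv]

theorem IsContFrac.cfFold_eq {l : List ℕ} {s r : ℕ} (h : IsContFrac l s r) :
    cfFold l (1, 0) = ((s : ℤ), (r : ℤ)) := by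
  obtain ⟨-, hsr, rfl | ⟨l', a, hl', rfl⟩⟩ := h
  · exact cfFold_contFrac hsr
  · rw [← cfFold_contFrac hsr, hl', cfFold_append, cfFold_append]
    simp

theorem contFrac_second_ne_zero {s r a b : ℕ} {l : List ℕ} (h : contFrac s r = a :: b :: l) :
    b ≠ 0 := by
  rw [contFrac] at h
  split_ifs at h with hr
  obtain ⟨-, h⟩ := List.cons.inj h
  rw [contFrac] at h
  split_ifs at h with hmod
  rw [← (List.cons.inj h).1]
  exact (Nat.div_pos (Nat.mod_lt _ (Nat.pos_of_ne_zero hr)).le (Nat.pos_of_ne_zero hmod)).ne'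

section

variable {c : ℕ → ℕ} {t u d p p' r s : ℕ}

theorem IsContFrac.second_ne_zero (ht : 3 ≤ t)
    (hc : IsContFrac ((List.range' 1 (t - 1)).map c ++ [c t + 2]) p' p) : c 2 ≠ 0 := by
  obtain ⟨-, -, h | ⟨l, a, -, h⟩⟩ := hc
  · obtain ⟨m, rfl⟩ := Nat.exists_eq_add_of_le' ht
    rw [show m + 3 - 1 = m + 1 + 1 by omega, List.range'_succ, List.range'_succ] at h
    exact contFrac_second_ne_zero h.symm
  · rw [List.append_cons l a [1]] at h
    simpa using (List.append_inj' h rfl).2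

theorem fSeq_self : fSeq c u d u = d := by rw [fSeq, if_neg (lt_irrefl u), if_pos rfl]

theorem map_fSeq_range'_one {m : ℕ} (h : m < u) :
    (List.range' 1 m).map (fSeq c u d) = (List.range' 1 m).map c := by
  refine List.map_congr_left fun k hk => ?_
  rw [List.mem_range'_1] at hk
  rw [fSeq, if_pos (by omega)]

theorem map_fSeq_range'_add_two (m : ℕ) :
    (List.range' (u + 1 + 1) m).map (fSeq c u d) = (List.range' (u + 1) m).map c := by
  rw [List.range'_succ_left, List.map_map]
  refine List.map_congr_left fun k hk => ?_
  rw [List.mem_range'_1] at hk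
  rw [Function.comp, fSeq, if_neg (by omega), if_neg (by omega), if_neg (by omega),
    Nat.add_sub_cancel]

theorem branchPair_fSeq (hut : u ≤ t) (hdc : d ≤ c u) :
    branchPair (fSeq c u d) u t = cfFold ((List.range' u (t - u)).map c ++ [c t + 2]) (1, 0) := by
  have hlast : cfFold [c t] (1, 2) = cfFold [c t + 2] (1, 0) := by simp
  obtain ⟨m, rfl⟩ := Nat.exists_eq_add_of_le hut
  have hrange : List.range' u (m + 1) = List.range' u m ++ [u + m] := List.range'_1_concat
  rw [Nat.add_sub_cancel_left, cfFold_append, ← hlast, ← cfFold_append, ← List.map_singleton,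
    ← List.map_append, ← hrange, branchPair, tailPair, show u + m + 2 - (u + 1) = m + 1 by omega,
    List.range'_succ, List.map_cons, map_fSeq_range'_add_two, List.range'_succ, List.map_cons,
    fSeq_self, cfFold_cons, cfFold_cons, fSeq, if_neg (by omega), if_neg (by omega), if_pos rfl,
    Nat.cast_sub hdc]
  congr 1
  ring

theorem cfFold_branchPair (hu : 1 ≤ u) (hut : u ≤ t) (hdc : d ≤ c u)
    (hc : IsContFrac ((List.range' 1 (t - 1)).map c ++ [c t + 2]) p' p) :
    cfFold ((List.range' 1 (u - 1)).map (fSeq c u d)) (branchPair (fSeq c u d) u t) =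
      ((p' : ℤ), (p : ℤ)) := by
  have hrange : List.range' 1 (u - 1) ++ List.range' u (t - u) = List.range' 1 (t - 1) := by
    rw [show t - 1 = u - 1 + (t - u) by omega, ← List.range'_append_1, Nat.add_sub_of_le hu]
  rw [map_fSeq_range'_one (by omega), branchPair_fSeq hut hdc, ← cfFold_append,
    ← List.append_assoc, ← List.map_append, hrange, hc.cfFold_eq]

theorem cfFold_fSeq (hu : 1 ≤ u) (hrs : IsContFrac ((List.range' 1 (u - 1)).map c ++ [d]) s r) :
    cfFold ((List.range' 1 (u - 1)).map (fSeq c u d)) (d, 1) = ((s : ℤ), (r : ℤ)) := by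
  rw [map_fSeq_range'_one (by omega), ← hrs.cfFold_eq, cfFold_append]
  simp

theorem le_of_isContFrac (hu : 1 ≤ u) (hut : u ≤ t) (hdc : d ≤ c u)
    (hc : IsContFrac ((List.range' 1 (t - 1)).map c ++ [c t + 2]) p' p)
    (hrs : IsContFrac ((List.range' 1 (u - 1)).map c ++ [d]) s r) : s ≤ p' ∧ r ≤ p := by
  have hle := cfFold_mono ((List.range' 1 (u - 1)).map (fSeq c u d))
    (le_branchPair (f := fSeq c u d) (u := u) (t := t))
  rw [fSeq_self, cfFold_branchPair hu hut hdc hc, cfFold_fSeq hu hrs] at hle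
  exact ⟨Nat.cast_le.1 hle.1, Nat.cast_le.1 hle.2⟩

/-! ### The bosonic side -/

theorem bosonicTerm_eq (N : ℕ) (k : ℤ) :
    bosonicTerm p p' r s N k = qPoch (2 * N) * bosTerm p' p s r ⊤ N k := by
  have h2N : ((2 : ℤ) * N).toNat = 2 * N := by omega
  rw [bosonicTerm, bosTerm, gaussPair_top_left, gaussPair_top_left, gauss_eq, gauss_eq, h2N,
    show (2 : ℤ) * N - (N + p * k) = N - k * p by ring,
    show (2 : ℤ) * N - (N + p * k + r) = N - (k * p + r) by ring,
    show (N : ℤ) + p * k + r = N + (k * p + r) by ring, mul_comm (p : ℤ) k]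
  ring

theorem hasFiniteSupport_bosonicTerm (hp : 0 < p) (hp' : 0 < p') (N : ℕ) :
    Function.HasFiniteSupport (bosonicTerm p p' r s N) := by
  rw [funext (bosonicTerm_eq N)]
  exact (hasFiniteSupport_bosTerm (mod_cast hp'.ne') (mod_cast hp.ne')
    (.inr (ENat.natCast_ne_top N))).mul_right _

/-- The polynomials in `q` with integer coefficients. -/
noncomputable def intPoly : Subalgebra ℤ (RatFunc ℚ) := (Polynomial.aeval (R := ℤ) q).range

theorem q_zpow_mem_intPoly {e : ℤ} (he : 0 ≤ e) : q ^ e ∈ intPoly := by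
  lift e to ℕ using he
  exact zpow_natCast q e ▸ pow_mem (⟨Polynomial.X, Polynomial.aeval_X q⟩ : q ∈ intPoly) e

theorem gauss_mem_intPoly (P : ℕ) (N : ℤ) : gauss P N ∈ intPoly := by
  induction P generalizing N with
  | zero =>
    rcases eq_or_ne N 0 with rfl | hN
    · exact gauss_zero_right 0 ▸ one_mem _
    · exact gauss_eq_zero (P := 0) (N := N) (by omega) ▸ zero_mem _
  | succ P ih =>
    rcases lt_or_ge N 0 with hN | hN
    · exact gauss_eq_zero (.inl hN) ▸ zero_mem _
    · rw [Nat.cast_add, Nat.cast_one, gauss_add_one (by omega)]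
      exact add_mem (ih _) (mul_mem (q_zpow_mem_intPoly hN) (ih _))

theorem bosTerm_exponent_nonneg {P' P S R : ℤ} (hS : 0 ≤ S) (hS' : S ≤ P') (hR : 0 ≤ R)
    (hR' : R ≤ P) (k : ℤ) : 0 ≤ k ^ 2 * P * P' + k * (P' * R - P * S) := by
  have hP' := hS.trans hS'
  have hP := hR.trans hR'
  rcases lt_trichotomy k 0 with hk | rfl | hk
  · calc 0 ≤ (-k) * (-k - 1) * (P * P') + (-k) * (P' * (P - R) + P * S) :=
          add_nonneg (mul_nonneg (mul_nonneg (by omega) (by omega)) (by positivity))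
            (mul_nonneg (by omega) (add_nonneg (mul_nonneg hP' (by omega)) (by positivity)))
      _ = _ := by ring
  · simp
  · calc 0 ≤ k * (k - 1) * (P * P') + k * (P * (P' - S) + P' * R) :=
          add_nonneg (mul_nonneg (mul_nonneg (by omega) (by omega)) (by positivity))
            (mul_nonneg (by omega) (add_nonneg (mul_nonneg hP (by omega)) (by positivity)))
      _ = _ := by ring

theorem bosonicTerm_mem_intPoly (hs : s ≤ p') (hr : r ≤ p) (N : ℕ) (k : ℤ) :
    bosonicTerm p p' r s N k ∈ intPoly := by
  have hs' : (s : ℤ) ≤ p' := mod_cast hs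
  have hr' : (r : ℤ) ≤ p := mod_cast hr
  have h2N : (2 : ℤ) * N = (2 * N : ℕ) := by push_cast; rfl
  rw [bosonicTerm, h2N, mul_comm ((k * p + r : ℤ))]
  exact sub_mem
    (mul_mem (q_zpow_mem_intPoly (bosTerm_exponent_nonneg s.cast_nonneg hs' r.cast_nonneg hr' k))
      (gauss_mem_intPoly _ _))
    (mul_mem (q_zpow_mem_intPoly (linear_mul_linear_nonneg s.cast_nonneg hs' r.cast_nonneg hr' k))
      (gauss_mem_intPoly _ _))

theorem exists_finsum_bosonicTerm_eq_aeval (hs : s ≤ p') (hr : r ≤ p) (N : ℕ) :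
    ∃ P : Polynomial ℤ, ∑ᶠ k : ℤ, bosonicTerm p p' r s N k = Polynomial.aeval q P := by
  obtain ⟨P, hP⟩ : ∑ᶠ k : ℤ, bosonicTerm p p' r s N k ∈ intPoly :=
    finsum_induction (· ∈ intPoly) (zero_mem _) (fun _ _ => add_mem)
      (bosonicTerm_mem_intPoly hs hr N)
  exact ⟨P, hP.symm⟩

theorem finite_setOf_admissible (hu : 1 ≤ u) (N : ℕ) : {n | Admissible c t u d N n}.Finite :=
  (boundedSeqs (fSeq c u d) u t (t + 1) 1 (⊤, N)).finite_toSet.subset fun _ hn =>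
    (mem_boundedSeqs_iff hu).2 hn

/-! ### The fermionic identities -/

theorem finsum_bosonicTerm_eq_finsum_seqTerm (hu : 1 ≤ u) (hut : u ≤ t) (hd : 1 ≤ d)
    (hdc : d ≤ c u) (hc : IsContFrac ((List.range' 1 (t - 1)).map c ++ [c t + 2]) p' p)
    (hrs : IsContFrac ((List.range' 1 (u - 1)).map c ++ [d]) s r) (N : ℕ) :
    ∑ᶠ k : ℤ, bosonicTerm p p' r s N k =
      qPoch (2 * N) * ∑ᶠ n ∈ {n | Admissible c t u d N n}, seqTerm u 1 (⊤, N) n := by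
  have hset : {n | Admissible c t u d N n} = boundedSeqs (fSeq c u d) u t (t + 1) 1 (⊤, N) :=
    Set.ext fun n => (mem_boundedSeqs_iff hu).symm
  have hsum := sum_seqTerm_head (f := fSeq c u d) (k := 1) (i := u - 1) (b := (⊤, N)) hut
    (by rw [fSeq_self]; omega) (by omega) (.inr (ENat.natCast_ne_top N))
  rw [fSeq_self, cfFold_branchPair hu hut hdc hc, cfFold_fSeq hu hrs, Nat.add_sub_cancel] at hsum
  rw [hset, finsum_mem_coe_finset, hsum, bosSum, mul_finsum]
  exact finsum_congr (bosonicTerm_eq N)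

theorem finsum_bosonicTerm_eq_finsum_fermTerm (hu : 1 < u) (hut : u ≤ t) (hd : 1 ≤ d)
    (hdc : d ≤ c u) (hc : IsContFrac ((List.range' 1 (t - 1)).map c ++ [c t + 2]) p' p)
    (hrs : IsContFrac ((List.range' 1 (u - 1)).map c ++ [d]) s r) (N : ℕ) :
    ∑ᶠ k : ℤ, bosonicTerm p p' r s N k = qPoch (2 * N) *
      ∑ᶠ n ∈ {n | Admissible c t u d N n}, fermTerm (fSeq c u d) u d N n := by
  rw [finsum_bosonicTerm_eq_finsum_seqTerm hu.le hut hd hdc hc hrs]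
  congr 1
  refine finsum_mem_congr rfl fun n hn => ?_
  have hf : fSeq c u d 2 ≠ 0 := by
    rcases Nat.eq_or_lt_of_le hu with rfl | hu
    · rw [fSeq_self]; omega
    · rw [fSeq, if_pos hu]
      exact hc.second_ne_zero (by omega)
  rw [seqTerm_eq_fermTerm hu hn.le_length ((admissible_iff hu.le).1 hn).2.2 fun _ => hf, fSeq_self]

theorem finsum_bosonicTerm_eq_finsum_fermTermOne (ht : 1 ≤ t) (hd : 1 ≤ d) (hdc : d ≤ c 1)
    (hc : IsContFrac ((List.range' 1 (t - 1)).map c ++ [c t + 2]) p' p)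
    (hrs : IsContFrac [d] s r) (N : ℕ) :
    ∑ᶠ k : ℤ, bosonicTerm p p' r s N k = qPoch (2 * N) *
      ∑ᶠ n ∈ {n | Admissible c t 1 d N n}, fermTermOne (fSeq c 1 d) d N n := by
  rw [finsum_bosonicTerm_eq_finsum_seqTerm le_rfl ht hd hdc hc hrs]
  congr 1
  refine finsum_mem_congr rfl fun n hn => ?_
  have hf (hn' : 3 < n.length) : fSeq c 1 d 3 ≠ 0 := by
    have := hn.length_le
    exact hc.second_ne_zero (by omega)
  rw [seqTerm_eq_fermTermOne hn.le_length ((admissible_iff le_rfl).1 hn).2.2 hf, fSeq_self]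

end

end BurgeTree

theorem mainTheorem5 (p p' : ℕ) (hp : 0 < p) (hp' : 0 < p') (hpp' : Nat.Coprime p p')
    (t : ℕ) (ht : 1 ≤ t) (c : ℕ → ℕ)
    (hc : BurgeTree.IsContFrac ((List.range' 1 (t - 1)).map c ++ [c t + 2]) p' p)
    (u : ℕ) (hu : 1 ≤ u) (hut : u ≤ t) (d : ℕ) (hd : 1 ≤ d) (hdc : d ≤ c u)
    (r s : ℕ) (hrs : BurgeTree.IsContFrac ((List.range' 1 (u - 1)).map c ++ [d]) s r)
    (N : ℕ) :
    -- both sums have finitely many non-zero terms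
    (Function.support (BurgeTree.bosonicTerm p p' r s N)).Finite ∧
    {n | BurgeTree.Admissible c t u d N n}.Finite ∧
    -- the common value is a polynomial in `q`
    (∃ P : Polynomial ℤ,
      ∑ᶠ k : ℤ, BurgeTree.bosonicTerm p p' r s N k = Polynomial.aeval BurgeTree.q P) ∧
    (1 < u →
      ∑ᶠ k : ℤ, BurgeTree.bosonicTerm p p' r s N k =
        BurgeTree.qPoch (2 * N) *
          ∑ᶠ n ∈ {n | BurgeTree.Admissible c t u d N n},
            BurgeTree.fermTerm (BurgeTree.fSeq c u d) u d N n) ∧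
    (u = 1 →
      ∑ᶠ k : ℤ, BurgeTree.bosonicTerm p p' r s N k =
        BurgeTree.qPoch (2 * N) *
          ∑ᶠ n ∈ {n | BurgeTree.Admissible c t u d N n},
            BurgeTree.fermTermOne (BurgeTree.fSeq c u d) d N n) := by
  open BurgeTree in
  obtain ⟨hs, hr⟩ := le_of_isContFrac hu hut hdc hc hrs
  refine ⟨hasFiniteSupport_bosonicTerm hp hp' N, finite_setOf_admissible hu N,
    exists_finsum_bosonicTerm_eq_aeval hs hr N, fun hu => ?_, ?_⟩
  · exact finsum_bosonicTerm_eq_finsum_fermTerm hu hut hd hdc hc hrs N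
  · rintro rfl
    exact finsum_bosonicTerm_eq_finsum_fermTermOne ht hd hdc hc hrs N
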